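/- Let $(X,d)$ be a compact geodesic metric space (any $x,y\in X$ are joined by a curve $\gamma:[0,1]\to X$ with $d(\gamma_s,\gamma_t)=|s-t|\,d(x,y)$), let $Y\subset X$ be open with $\emptyset\neq Y\neq X$, and let $p\in[1,\infty)$. Put $d^*(x,y)=\inf_{z\in X\setminus Y}[d(x,z)+d(z,y)]$ for $x,y\in X$. Let $\mathcal P^{sub}(Y)$ be the set of Borel measures $\mu$ on $Y$ with $\mu(Y)\le 1$ (regarded, where needed, as measures on $X$ by extension by $0$), and let $\tilde{\mathcal P}(Y|X)$ be the set of pairs $\sigma=(\sigma^+,\sigma^-)$ of Borel measures on $X$ with $\sigma^+|_{X\setminus Y}=\sigma^-|_{X\setminus Y}$ and $\sigma^+(X)+\sigma^-(X)=1$. For $\sigma,\tau\in\tilde{\mathcal P}(Y|X)$ let $$\tilde W_p(\sigma,\tau)=\inf\Big\{\int d^p\,dq^{++}+\int (d^*)^p\,dq^{+-}+\int (d^*)^p\,dq^{-+}+\int d^p\,dq^{--}\Big\}^{1/p},$$ where the infimum is over all quadruples of Borel measures $q^{ij}$ ($i,j\in\{+,-\}$) on $X\times X$ such that the first marginal of $q^{i+}+q^{i-}$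 is $\sigma^i$ and the second marginal of $q^{+j}+q^{-j}$ is $\tau^j$, for all $i,j\in\{+,-\}$. For $\mu,\nu\in\mathcal P^{sub}(Y)$ let $$W^0_p(\mu,\nu)=\inf\{\tilde W_p(\sigma,\tau) : \sigma,\tau\in\tilde{\mathcal P}(Y|X),\ \sigma^+-\sigma^-=\mu,\ \tau^+-\tau^-=\nu\},$$ and let $\mathcal P^{sub}_p(Y)$ be the set of $\mu\in\mathcal P^{sub}(Y)$ with $W^0_p(\mu,\delta_y)<\infty$ for some $y\in Y$. For $\mu,\nu\in\mathcal P^{sub}_p(Y)$ let $$W^\flat_p(\mu,\nu)=\inf\Big\{\sum_{i=1}^n W^0_p(\eta_{i-1},\eta_i) : n\in\mathbb N,\ \eta_i\in\mathcal P^{sub}_p(Y),\ \eta_0=\mu,\ \eta_n=\nu\Big\}.$$ For a curve $\eta:[0,1]\to\mathcal P^{sub}_p(Y)$ let $L^\flat_p(\eta)=\sup\{\sum_{i=1}^n W^\flat_p(\eta_{s_{i-1}},\eta_{s_i}) : n\in\mathbb N,\ 0=s_0<\dots<s_n=1\}$, and let $$W^\sharp_p(\mu,\nu)=\inf\{L^\flat_p(\eta)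 : \eta:[0,1]\to\mathcal P^{sub}_p(Y)\text{ is } W^\flat_p\text{-continuous},\ \eta_0=\mu,\ \eta_1=\nu\}.$$ Then $W^\sharp_p$ is a (finite) metric on $\mathcal P^{sub}_p(Y)$, and with this metric $\mathcal P^{sub}_p(Y)$ is complete, separable and geodesic. Moreover, for all $\mu_n,\mu\in\mathcal P^{sub}_p(Y)$ the following are equivalent: (i) $\mu_n\to\mu$ vaguely on $Y$, that is, $\int f\,d\mu_n\to\int f\,d\mu$ for every continuous $f:Y\to\mathbb R$ with compact support in $Y$; (ii) $W^\sharp_p(\mu_n,\mu)\to0$ as $n\to\infty$. -/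

import Mathlib

open Set Filter Topology MeasureTheory
open scoped ENNReal

namespace TransportAnnihilation

noncomputable section

/-- A geodesic metric space: any two points are joined by a curve `γ : [0,1] → α` with
`dist (γ s) (γ t) = |s - t| * dist x y` for all `s`, `t`. -/
def IsGeodesicSpace (α : Type*) [MetricSpace α] : Prop :=
  ∀ x y : α, ∃ γ : unitInterval → α, γ 0 = x ∧ γ 1 = y ∧
    ∀ s t : unitInterval, dist (γ s) (γ t) = |(s : ℝ) - (t : ℝ)| * dist x y

/-- The distance `d*(x, y) = inf_{z ∈ X \ Y} [d(x,z) + d(z,y)]` between a particle at `x` and an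
antiparticle at `y`. -/
def dStar {X : Type*} [MetricSpace X] (Y : Set X) (x y : X) : ℝ≥0∞ :=
  ⨅ z ∈ Yᶜ, (edist x z + edist z y)

/-- Subprobability measures on `Y`: Borel measures on (the subspace) `Y` of mass at most one. -/
def SubProb {X : Type*} [MeasurableSpace X] (Y : Set X) : Type _ :=
  {μ : Measure Y // μ Set.univ ≤ 1}

/-- A subprobability measure on `Y`, regarded as a measure on `X` (extended by zero). -/
def SubProb.ext {X : Type*} [MeasurableSpace X] {Y : Set X} (μ : SubProb Y) : Measure X :=
  μ.1.map Subtype.val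

/-- The Dirac measure at a point `y ∈ Y`. -/
def SubProb.dirac {X : Type*} [MeasurableSpace X] {Y : Set X} (y : Y) : SubProb Y :=
  ⟨Measure.dirac y, le_of_eq measure_univ⟩

/-- Charged probability measures: pairs `(σ⁺, σ⁻)` of measures on `X` that agree on `X \ Y` and
satisfy `σ⁺(X) + σ⁻(X) = 1` (so that both of them are subprobability measures). -/
structure ChargedProb {X : Type*} [MeasurableSpace X] (Y : Set X) where
  pos : Measure X
  neg : Measure X
  restrict_compl : pos.restrict Yᶜ = neg.restrict Yᶜ
  mass : pos Set.univ + neg Set.univ = 1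

/-- The effective measure `σ⁺ - σ⁻` of `σ` is `μ`. All measures involved are finite, so this is
expressed by `σ⁺ = σ⁻ + μ`. -/
def ChargedProb.HasEffectiveMeasure {X : Type*} [MeasurableSpace X] {Y : Set X}
    (σ : ChargedProb Y) (μ : SubProb Y) : Prop :=
  σ.pos = σ.neg + μ.ext

/-- A coupling of the charged measures `σ` and `τ`: measures `q^{ij}` on `X × X`,
`i, j ∈ {+,-}`, where `q^{ij}` transports a part `σ^{ij}` of `σ^i` onto a part `τ^{ij}` of `τ^j`,
with `σ^i = σ^{i+} + σ^{i-}` and `τ^j = τ^{+j} + τ^{-j}`. In particular `∑ q^{ij}` is a coupling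
of the total measures `σ⁺ + σ⁻` and `τ⁺ + τ⁻`. -/
structure ChargedCoupling {X : Type*} [MeasurableSpace X] {Y : Set X}
    (σ τ : ChargedProb Y) where
  pp : Measure (X × X)
  pm : Measure (X × X)
  mp : Measure (X × X)
  mm : Measure (X × X)
  fst_pos : pp.fst + pm.fst = σ.pos
  fst_neg : mp.fst + mm.fst = σ.neg
  snd_pos : pp.snd + mp.snd = τ.pos
  snd_neg : pm.snd + mm.snd = τ.neg

/-- The `p`-cost of a charged coupling: mass keeping its charge is moved at cost `d^p`, mass
changing its charge at cost `(d*)^p`. -/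
def ChargedCoupling.cost {X : Type*} [MetricSpace X] [MeasurableSpace X] {Y : Set X}
    {σ τ : ChargedProb Y} (q : ChargedCoupling σ τ) (p : ℝ) : ℝ≥0∞ :=
  (∫⁻ z, edist z.1 z.2 ^ p ∂q.pp) + (∫⁻ z, dStar Y z.1 z.2 ^ p ∂q.pm) +
    (∫⁻ z, dStar Y z.1 z.2 ^ p ∂q.mp) + (∫⁻ z, edist z.1 z.2 ^ p ∂q.mm)

/-- The `L^p`-transportation distance between charged probability measures. -/
def Wtilde {X : Type*} [MetricSpace X] [MeasurableSpace X] {Y : Set X} (p : ℝ)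
    (σ τ : ChargedProb Y) : ℝ≥0∞ :=
  (⨅ q : ChargedCoupling σ τ, q.cost p) ^ (1 / p)

/-- The transportation-annihilation pre-distance. -/
def WZero {X : Type*} [MetricSpace X] [MeasurableSpace X] {Y : Set X} (p : ℝ)
    (μ ν : SubProb Y) : ℝ≥0∞ :=
  ⨅ (σ : ChargedProb Y) (τ : ChargedProb Y) (_ : σ.HasEffectiveMeasure μ)
    (_ : τ.HasEffectiveMeasure ν), Wtilde p σ τ

/-- Subprobability measures on `Y` at finite pre-distance from a Dirac measure at a point
of `Y`. -/
def SubProbP {X : Type*} [MetricSpace X] [MeasurableSpace X] (p : ℝ) (Y : Set X) : Type _ :=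
  {μ : SubProb Y // ∃ y : Y, WZero p μ (SubProb.dirac y) < ∞}

/-- The largest pseudo-metric below the pre-distance: infimum over finite chains. -/
def WFlat {X : Type*} [MetricSpace X] [MeasurableSpace X] {Y : Set X} {p : ℝ}
    (μ ν : SubProbP p Y) : ℝ≥0∞ :=
  ⨅ (n : ℕ) (η : Fin (n + 1) → SubProbP p Y) (_ : η 0 = μ) (_ : η (Fin.last n) = ν),
    ∑ i : Fin n, WZero p (η i.castSucc).1 (η i.succ).1

/-- Length of a curve with respect to `WFlat`: supremum over the partitions
`0 = s₀ < ⋯ < sₙ = 1`. -/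
def lengthFlat {X : Type*} [MetricSpace X] [MeasurableSpace X] {Y : Set X} {p : ℝ}
    (η : unitInterval → SubProbP p Y) : ℝ≥0∞ :=
  ⨆ (n : ℕ) (s : Fin (n + 1) → unitInterval) (_ : StrictMono s) (_ : s 0 = 0) (_ : s (Fin.last n) = 1),
    ∑ i : Fin n, WFlat (η (s i.castSucc)) (η (s i.succ))

/-- Continuity of a curve with respect to `WFlat`. -/
def ContinuousFlat {X : Type*} [MetricSpace X] [MeasurableSpace X] {Y : Set X} {p : ℝ}
    (η : unitInterval → SubProbP p Y) : Prop :=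
  ∀ t : unitInterval, Tendsto (fun s : unitInterval => WFlat (η s) (η t)) (𝓝 t) (𝓝 0)

/-- The transportation-annihilation distance: the length metric induced by `WFlat`. -/
def WSharp {X : Type*} [MetricSpace X] [MeasurableSpace X] {Y : Set X} {p : ℝ}
    (μ ν : SubProbP p Y) : ℝ≥0∞ :=
  ⨅ (η : unitInterval → SubProbP p Y) (_ : ContinuousFlat η) (_ : η 0 = μ) (_ : η 1 = ν), lengthFlat η

/-- Vague convergence on `Y`: convergence of the integrals of all continuous functions on `Y`
with compact support (in `Y`). -/
def VagueTendsto {X : Type*} [MetricSpace X] [MeasurableSpace X] {Y : Set X}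
    (μs : ℕ → SubProb Y) (μ : SubProb Y) : Prop :=
  ∀ f : Y → ℝ, Continuous f → HasCompactSupport f →
    Tendsto (fun n => ∫ y, f y ∂(μs n).1) atTop (𝓝 (∫ y, f y ∂μ.1))

end

end TransportAnnihilation

/-!
Let `Φ` be the restriction map from the probability measures on `X` to the subprobability measures
on `Y`. It is onto, since missing mass can be placed at a point outside `Y`. The proof compares
`WSharp` from both sides with quantities living on `X`.

*Upper bound.* A coupling of probability measures `ρ`, `ν` on `X` induces a charged coupling: mass
in `Y` is positive, mass outside `Y` is split evenly between both charges, and since `d* ≤ d` as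
soon as one of the points lies outside `Y`, the cost does not increase (`WZero_restrict_le`).
Since `X` is geodesic, couplings can be interpolated (`exists_interpolation`), so that the curve of
restrictions is Lipschitz, and `WSharp (Φ ρ) (Φ ν)` is at most the `L^p`-transport cost on `X`
(`WSharp_restrict_le`). As this cost is small for weakly close measures, `Φ` is continuous from the
weak topology to `WSharp` (`tendsto_WSharp_restrict`).

*Lower bound.* If `f` is 1-Lipschitz and vanishes outside `Y`, then its odd extension to two copies
of `X` glued along the complement of `Y` is 1-Lipschitz, so that `|∫ f dμ - ∫ f dν|` is at most
`WZero μ ν`, hence at most `WFlat μ ν ≤ WSharp μ ν`. These functions determine a measure on `Y`, so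
`WSharp` separates points (`eq_of_WFlat_eq_zero`).

*Conclusion.* The probability measures on the compact space `X` form a weakly compact space, and
`Φ` maps it continuously onto the subprobability measures with the metric `WSharp`, which is
therefore compact, in particular complete and separable. Being a continuous surjection of a compact
space onto a Hausdorff space, `Φ` is a quotient map, so that integration of a compactly supported
function is `WSharp`-continuous; as these integrals separate points, by compactness they induce the
metric topology, which is thus the vague topology. Finally, a compact metric that is the length
distance of a pseudo-metric is geodesic
(`isGeodesicSpace_of_compactSpace_of_edist_eq_lengthEDist`).
-/

namespace TransportAnnihilation

/-! ### The length distance of a pseudo-metric space -/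

section LengthDistance

variable {M : Type*} [PseudoEMetricSpace M]

/-- The length distance: the infimum of the lengths of the continuous paths between two points. -/
noncomputable def lengthEDist (x y : M) : ℝ≥0∞ :=
  ⨅ γ : Path x y, eVariationOn γ univ

theorem edist_le_lengthEDist (x y : M) : edist x y ≤ lengthEDist x y := by
  refine le_iInf fun γ => ?_
  simpa using eVariationOn.edist_le γ (mem_univ 0) (mem_univ 1)

theorem lengthEDist_self (x : M) : lengthEDist x x = 0 := by
  refine le_antisymm (iInf_le_of_le (Path.refl x) (le_of_eq ?_)) zero_le
  refine eVariationOn.constant_on ?_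
  rintro _ ⟨a, -, rfl⟩ _ ⟨b, -, rfl⟩
  rfl

theorem lengthEDist_comm_le (x y : M) : lengthEDist y x ≤ lengthEDist x y := by
  refine le_iInf fun γ => iInf_le_of_le γ.symm ?_
  exact eVariationOn.comp_le_of_antitoneOn γ unitInterval.symm
    (unitInterval.strictAnti_symm.antitone.antitoneOn _) (mapsTo_univ _ _)

theorem lengthEDist_comm (x y : M) : lengthEDist x y = lengthEDist y x :=
  le_antisymm (lengthEDist_comm_le y x) (lengthEDist_comm_le x y)

theorem eVariationOn_path_trans_le {x y z : M} (γ : Path x y) (γ' : Path y z) :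
    eVariationOn (γ.trans γ') univ ≤ eVariationOn γ univ + eVariationOn γ' univ := by
  let h : unitInterval := ⟨1 / 2, by norm_num, by norm_num⟩
  have huniv : (univ : Set unitInterval) = univ ∩ Icc 0 1 := by
    ext t; simp [unitInterval.le_one']
  rw [huniv, ← eVariationOn.Icc_add_Icc (γ.trans γ') (b := h) unitInterval.nonneg'
    unitInterval.le_one' (mem_univ _), ← huniv, univ_inter, univ_inter]
  refine add_le_add ?_ ?_
  · have hcongr : EqOn (γ.trans γ')
        (γ ∘ fun t : unitInterval => projIcc (0 : ℝ) 1 zero_le_one (2 * t)) (Icc 0 h) := by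
      intro t ht
      have ht2 : (t : ℝ) ≤ 1 / 2 := ht.2
      rw [Path.trans_apply, dif_pos ht2]
      simp only [Function.comp_apply]
      rw [projIcc_of_mem zero_le_one (x := 2 * (t : ℝ)) ⟨by linarith [t.2.1], by linarith⟩]
    rw [eVariationOn.congr hcongr]
    refine eVariationOn.comp_le_of_monotoneOn _ _ (fun s _ t _ hst => ?_) (mapsTo_univ _ _)
    exact monotone_projIcc _ (by have : (s : ℝ) ≤ t := hst; linarith)
  · have hcongr : EqOn (γ.trans γ')
        (γ' ∘ fun t : unitInterval => projIcc (0 : ℝ) 1 zero_le_one (2 * t - 1)) (Icc h 1) := by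
      intro t ht
      have ht2 : 1 / 2 ≤ (t : ℝ) := ht.1
      have hex := Path.extend_trans_of_half_le γ γ' (t := (t : ℝ)) ht2
      rw [Path.extend_apply _ t.2] at hex
      rw [hex]
      rfl
    rw [eVariationOn.congr hcongr]
    refine eVariationOn.comp_le_of_monotoneOn _ _ (fun s _ t _ hst => ?_) (mapsTo_univ _ _)
    exact monotone_projIcc _ (by have : (s : ℝ) ≤ t := hst; linarith)

theorem lengthEDist_triangle (x y z : M) :
    lengthEDist x z ≤ lengthEDist x y + lengthEDist y z := by
  refine ENNReal.le_iInf_add_iInf fun γ γ' => ?_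
  exact iInf_le_of_le (γ.trans γ') (eVariationOn_path_trans_le γ γ')

theorem lengthEDist_le_eVariationOn_Icc {f : unitInterval → M} (hf : Continuous f)
    {s t : unitInterval} (hst : s ≤ t) :
    lengthEDist (f s) (f t) ≤ eVariationOn f (Icc s t) := by
  have hst' : (s : ℝ) ≤ t := hst
  have hmem : ∀ u : unitInterval, (s : ℝ) + u * (t - s) ∈ Icc (s : ℝ) t := fun u =>
    ⟨by nlinarith [u.2.1], by nlinarith [u.2.2]⟩
  let φ : unitInterval → unitInterval := fun u =>
    ⟨s + u * (t - s), s.2.1.trans (hmem u).1, (hmem u).2.trans t.2.2⟩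
  have hφ : Continuous φ := by
    refine Continuous.subtype_mk ?_ _
    fun_prop
  let γ : Path (f s) (f t) :=
    { toFun := f ∘ φ
      continuous_toFun := hf.comp hφ
      source' := by
        have : φ 0 = s := Subtype.ext (by simp [φ])
        simp [this]
      target' := by
        have : φ 1 = t := Subtype.ext (by simp [φ])
        simp [this] }
  refine iInf_le_of_le γ ?_
  change eVariationOn (f ∘ φ) univ ≤ _
  refine eVariationOn.comp_le_of_monotoneOn f φ (fun u _ v _ huv => ?_) (fun u _ => hmem u)
  have huv' : (u : ℝ) ≤ v := huv
  change (s : ℝ) + u * (t - s) ≤ s + v * (t - s)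
  nlinarith

/-- The arc length function of a continuous curve of finite length is continuous. -/
theorem continuous_arcLength {f : unitInterval → M} (hf : Continuous f)
    (hfin : eVariationOn f univ ≠ ∞) :
    Continuous fun t : unitInterval => (eVariationOn f (Icc 0 t)).toReal := by
  have hne : ∀ s : Set unitInterval, eVariationOn f s ≠ ∞ := fun s =>
    ((eVariationOn.mono f (subset_univ s)).trans_lt (lt_top_iff_ne_top.2 hfin)).ne
  have hadd : ∀ s t : unitInterval, s ≤ t →
      (eVariationOn f (Icc 0 t)).toReal - (eVariationOn f (Icc 0 s)).toReal
        = (eVariationOn f (Icc s t)).toReal := by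
    intro s t hst
    have := eVariationOn.Icc_add_Icc f (s := univ) (a := 0) unitInterval.nonneg' hst (mem_univ s)
    simp only [univ_inter] at this
    rw [← this, ENNReal.toReal_add (hne _) (hne _)]
    ring
  refine continuous_iff_continuousAt.2 fun t => ?_
  have h1 : Tendsto (fun y => (eVariationOn f (Icc y t)).toReal) (𝓝 t) (𝓝 0) := by
    have := BoundedVariationOn.tendsto_eVariationOn_Icc_zero_left (f := f) (s := univ) hfin
      (x := t) hf.continuousWithinAt
    simp only [univ_inter, nhdsWithin_univ] at this
    exact (ENNReal.tendsto_toReal ENNReal.zero_ne_top).comp this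
  have h2 : Tendsto (fun y => (eVariationOn f (Icc t y)).toReal) (𝓝 t) (𝓝 0) := by
    have := BoundedVariationOn.tendsto_eVariationOn_Icc_zero_right (f := f) (s := univ) hfin
      t hf.continuousWithinAt
    simp only [univ_inter, nhdsWithin_univ] at this
    exact (ENNReal.tendsto_toReal ENNReal.zero_ne_top).comp this
  refine tendsto_iff_dist_tendsto_zero.2 ?_
  refine squeeze_zero (fun _ => dist_nonneg) (fun y => ?_) (by simpa using h1.add h2)
  rw [Real.dist_eq]
  rcases le_total y t with h | h
  · rw [abs_sub_comm, hadd y t h, abs_of_nonneg ENNReal.toReal_nonneg]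
    exact le_add_of_nonneg_right ENNReal.toReal_nonneg
  · rw [hadd t y h, abs_of_nonneg ENNReal.toReal_nonneg]
    exact le_add_of_nonneg_left ENNReal.toReal_nonneg

theorem lengthEDist_le_of_lipschitzWith {K : NNReal}
    {f : unitInterval → M} (hf : LipschitzWith K f) : lengthEDist (f 0) (f 1) ≤ K := by
  refine iInf_le_of_le ⟨⟨f, hf.continuous⟩, rfl, rfl⟩ ?_
  refine ((hf.lipschitzOnWith (s := univ)).comp_eVariationOn_le
    (g := (id : unitInterval → unitInterval)) (mapsTo_univ _ _)).trans ?_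
  have h1 : eVariationOn (id : unitInterval → unitInterval) univ
      = eVariationOn (id ∘ (Subtype.val : unitInterval → ℝ)) univ := rfl
  rw [h1, eVariationOn.comp_eq_of_monotoneOn id (Subtype.val : unitInterval → ℝ)
    (fun _ _ _ _ h => h), image_univ, Subtype.range_coe, eVariationOn_id_Icc]
  simp

/-- A path of finite length can be parametrized proportionally to arc length; only the resulting
bound for the length distance is recorded. -/
theorem exists_lipschitz_reparametrization {f : unitInterval → M} (hf : Continuous f)
    (hfin : eVariationOn f univ ≠ ∞) :
    ∃ τ : unitInterval → unitInterval, lengthEDist (f (τ 0)) (f 0) = 0 ∧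
      lengthEDist (f (τ 1)) (f 1) = 0 ∧ ∀ s t : unitInterval,
        lengthEDist (f (τ s)) (f (τ t))
          ≤ ENNReal.ofReal (|(s : ℝ) - t| * (eVariationOn f univ).toReal) := by
  set v : unitInterval → ℝ := fun t => (eVariationOn f (Icc 0 t)).toReal with hv
  have hne : ∀ s : Set unitInterval, eVariationOn f s ≠ ∞ := fun s =>
    ((eVariationOn.mono f (subset_univ s)).trans_lt (lt_top_iff_ne_top.2 hfin)).ne
  have hv0 : v 0 = 0 := by simp [hv, eVariationOn.subsingleton]
  have hv1 : v 1 = (eVariationOn f univ).toReal := by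
    have : Icc (0 : unitInterval) 1 = univ := by
      ext t; simp [unitInterval.le_one']
    simp [hv, this]
  have hle : ∀ s t : unitInterval, s ≤ t →
      lengthEDist (f s) (f t) ≤ ENNReal.ofReal (v t - v s) := by
    intro s t hst
    have := eVariationOn.Icc_add_Icc f (s := univ) (a := 0) unitInterval.nonneg' hst (mem_univ s)
    simp only [univ_inter] at this
    refine (lengthEDist_le_eVariationOn_Icc hf hst).trans (le_of_eq ?_)
    simp only [hv]
    rw [← this, ENNReal.toReal_add (hne _) (hne _), add_sub_cancel_left,
      ENNReal.ofReal_toReal (hne _)]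
  have habs : ∀ s t : unitInterval,
      lengthEDist (f s) (f t) ≤ ENNReal.ofReal |v s - v t| := by
    intro s t
    rcases le_total s t with h | h
    · refine (hle s t h).trans (ENNReal.ofReal_le_ofReal ?_)
      rw [abs_sub_comm]; exact le_abs_self _
    · rw [lengthEDist_comm]
      exact (hle t s h).trans (ENNReal.ofReal_le_ofReal (le_abs_self _))
  have hex : ∀ u : unitInterval, ∃ t, v t = u * (eVariationOn f univ).toReal := by
    intro u
    refine mem_range_of_exists_le_of_exists_ge (continuous_arcLength hf hfin) ⟨0, ?_⟩ ⟨1, ?_⟩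
    · change v 0 ≤ _
      rw [hv0]
      exact mul_nonneg u.2.1 ENNReal.toReal_nonneg
    · change _ ≤ v 1
      rw [hv1]
      exact mul_le_of_le_one_left ENNReal.toReal_nonneg u.2.2
  choose τ hτ using hex
  refine ⟨τ, ?_, ?_, fun s t => ?_⟩
  · refine le_antisymm ((habs _ _).trans ?_) zero_le
    simp [hτ, hv0]
  · refine le_antisymm ((habs _ _).trans ?_) zero_le
    simp [hτ, hv1]
  · refine (habs _ _).trans (le_of_eq ?_)
    rw [hτ, hτ, ← sub_mul, abs_mul,
      abs_of_nonneg (ENNReal.toReal_nonneg (a := eVariationOn f univ))]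

/-- If the length distance of a pseudo-metric space is a compact metric, then this metric is
geodesic: arc length parametrizations of almost shortest paths converge pointwise along an
ultrafilter. -/
theorem isGeodesicSpace_of_compactSpace_of_edist_eq_lengthEDist {N : Type*} [MetricSpace N]
    [CompactSpace N] (e : N ≃ M) (he : ∀ x y : N, edist x y = lengthEDist (e x) (e y)) :
    IsGeodesicSpace N := by
  intro x y
  have hdist : ∀ a b : N, ∀ r : ℝ, 0 ≤ r → lengthEDist (e a) (e b) ≤ ENNReal.ofReal r →
      dist a b ≤ r := by
    intro a b r hr h
    rwa [← he, edist_le_ofReal hr] at h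
  have happrox : ∀ ε : ℝ, 0 < ε → ∃ c : unitInterval → N, c 0 = x ∧ c 1 = y ∧
      ∀ s t, dist (c s) (c t) ≤ |(s : ℝ) - t| * (dist x y + ε) := by
    intro ε hε
    have hlt : lengthEDist (e x) (e y) < ENNReal.ofReal (dist x y + ε) := by
      rw [← he, edist_dist]
      exact (ENNReal.ofReal_lt_ofReal_iff (by positivity)).2 (by linarith)
    obtain ⟨γ, hγ⟩ := iInf_lt_iff.1 hlt
    have hfin : eVariationOn γ univ ≠ ∞ := (hγ.trans ENNReal.ofReal_lt_top).ne
    obtain ⟨τ, h0, h1, hτ⟩ := exists_lipschitz_reparametrization γ.continuous hfin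
    refine ⟨fun s => e.symm (γ (τ s)), ?_, ?_, fun s t => ?_⟩
    · refine dist_le_zero.1 (hdist _ _ 0 le_rfl ?_)
      simpa using h0.le
    · refine dist_le_zero.1 (hdist _ _ 0 le_rfl ?_)
      simpa using h1.le
    · refine hdist _ _ _ (by positivity) ?_
      simp only [Equiv.apply_symm_apply]
      refine (hτ s t).trans (ENNReal.ofReal_le_ofReal ?_)
      refine mul_le_mul_of_nonneg_left ?_ (abs_nonneg _)
      exact ENNReal.toReal_le_of_le_ofReal (by positivity) hγ.le
  have : Nonempty N := ⟨x⟩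
  choose! c hc0 hc1 hc using happrox
  have hpos : ∀ n : ℕ, (0 : ℝ) < 1 / (n + 1) := fun n => by positivity
  let U : Ultrafilter ℕ := hyperfilter ℕ
  have hU : (U : Filter ℕ) ≤ atTop := Nat.hyperfilter_le_atTop
  have hlim : ∀ s, ∃ z : N, Tendsto (fun n : ℕ => c (1 / (n + 1)) s) U (𝓝 z) := by
    intro s
    obtain ⟨z, -, hz⟩ := isCompact_univ.ultrafilter_le_nhds
      (U.map fun n : ℕ => c (1 / (n + 1)) s) (by simp)
    exact ⟨z, hz⟩
  choose g hg using hlim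
  have hle : ∀ s t, dist (g s) (g t) ≤ |(s : ℝ) - t| * dist x y := by
    intro s t
    have h1 : Tendsto (fun n : ℕ => |(s : ℝ) - t| * (dist x y + 1 / ((n : ℝ) + 1))) U
        (𝓝 (|(s : ℝ) - t| * (dist x y + 0))) :=
      ((tendsto_one_div_add_atTop_nhds_zero_nat.mono_left hU).const_add _).const_mul _
    rw [add_zero] at h1
    exact le_of_tendsto_of_tendsto' ((hg s).dist (hg t)) h1 fun n => hc _ (hpos n) s t
  have hg0 : g 0 = x := tendsto_nhds_unique (hg 0)
    (tendsto_const_nhds.congr fun n => (hc0 _ (hpos n)).symm)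
  have hg1 : g 1 = y := tendsto_nhds_unique (hg 1)
    (tendsto_const_nhds.congr fun n => (hc1 _ (hpos n)).symm)
  refine ⟨g, hg0, hg1, ?_⟩
  -- A curve of speed at most `dist x y` from `x` to `y` in unit time cannot be slower anywhere.
  have hge : ∀ s t : unitInterval, s ≤ t → |(s : ℝ) - t| * dist x y ≤ dist (g s) (g t) := by
    intro s t hst
    have hst' : (s : ℝ) ≤ t := hst
    have h1 := hle 0 s
    have h2 := hle t 1
    have h3 := dist_triangle4 (g 0) (g s) (g t) (g 1)
    rw [hg0, hg1] at h3
    rw [hg0] at h1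
    rw [hg1] at h2
    have hs := s.2.1
    have ht := t.2.2
    rw [abs_of_nonpos (by simpa using hs)] at h1
    rw [abs_of_nonpos (by simpa using ht)] at h2
    rw [abs_of_nonpos (by linarith)]
    simp only [Icc.coe_zero, Icc.coe_one] at h1 h2
    nlinarith
  intro s t
  refine le_antisymm (hle s t) ?_
  rcases le_total s t with h | h
  · exact hge s t h
  · rw [abs_sub_comm, dist_comm (g s)]
    exact hge t s h

end LengthDistance

/-! ### The length of a curve as a supremum over partitions -/

section Partition

variable {M : Type*} [PseudoEMetricSpace M]

/-- The points of a partition can be preceded by `0` without decreasing the sum of distances. -/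
theorem exists_strictMonoOn_zero (f : unitInterval → M) (n : ℕ) (u : ℕ → unitInterval)
    (hu : StrictMonoOn u (Iic n)) : ∃ (m : ℕ) (v : ℕ → unitInterval), StrictMonoOn v (Iic m) ∧
      v 0 = 0 ∧ ∑ i ∈ Finset.range n, edist (f (u (i + 1))) (f (u i))
        ≤ ∑ i ∈ Finset.range m, edist (f (v (i + 1))) (f (v i)) := by
  by_cases h0 : u 0 = 0
  · exact ⟨n, u, hu, h0, le_rfl⟩
  refine ⟨n + 1, fun k => if k = 0 then 0 else u (k - 1), ?_, by simp, ?_⟩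
  · intro i hi j hj hij
    simp only [mem_Iic] at hi hj
    have hj0 : j ≠ 0 := by omega
    rcases eq_or_ne i 0 with rfl | hi0
    · have : 0 < u 0 := lt_of_le_of_ne unitInterval.nonneg' (Ne.symm h0)
      simpa [hj0] using this.trans_le (hu.monotoneOn (by simp) (by simp; omega) (Nat.zero_le _))
    · simpa [hj0, hi0] using hu (by simp; omega) (by simp; omega) (by omega : i - 1 < j - 1)
  · rw [Finset.sum_range_succ']
    simp

/-- The points of a partition can be followed by `1` without decreasing the sum of distances. -/
theorem exists_strictMonoOn_one (f : unitInterval → M) (n : ℕ) (u : ℕ → unitInterval)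
    (hu : StrictMonoOn u (Iic n)) : ∃ (m : ℕ) (v : ℕ → unitInterval), StrictMonoOn v (Iic m) ∧
      v 0 = u 0 ∧ v m = 1 ∧ ∑ i ∈ Finset.range n, edist (f (u (i + 1))) (f (u i))
        ≤ ∑ i ∈ Finset.range m, edist (f (v (i + 1))) (f (v i)) := by
  by_cases h1 : u n = 1
  · exact ⟨n, u, hu, rfl, h1, le_rfl⟩
  refine ⟨n + 1, fun k => if k ≤ n then u k else 1, ?_, by simp, by simp, ?_⟩
  · intro i hi j hj hij
    simp only [mem_Iic] at hi hj
    have hin : i ≤ n := by omega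
    by_cases hjn : j ≤ n
    · simpa [hin, hjn] using hu hin hjn hij
    · have : u n < 1 := lt_of_le_of_ne unitInterval.le_one' h1
      simpa [hin, hjn] using (hu.monotoneOn hin (by simp) hin).trans_lt this
  · rw [Finset.sum_range_succ]
    refine le_add_of_le_of_nonneg (Finset.sum_le_sum fun i hi => ?_) zero_le
    have : i < n := Finset.mem_range.1 hi
    simp [show i + 1 ≤ n by omega, show i ≤ n by omega]

theorem eVariationOn_univ_eq_iSup_partition (f : unitInterval → M) :
    eVariationOn f univ = ⨆ (n : ℕ) (s : Fin (n + 1) → unitInterval) (_ : StrictMono s)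
      (_ : s 0 = 0) (_ : s (Fin.last n) = 1),
        ∑ i : Fin n, edist (f (s i.castSucc)) (f (s i.succ)) := by
  refine le_antisymm ?_ ?_
  · rw [eVariationOn.eVariationOn_eq_strictMonoOn]
    refine iSup_le ?_
    rintro ⟨n, u, hu, -⟩
    obtain ⟨k, v, hv, hv0, hle⟩ := exists_strictMonoOn_zero f n u hu
    obtain ⟨m, w, hw, hw0, hw1, hle'⟩ := exists_strictMonoOn_one f k v hv
    refine (hle.trans hle').trans ?_
    refine le_iSup_of_le m (le_iSup_of_le (fun i : Fin (m + 1) => w i) ?_)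
    refine le_iSup_of_le (fun i j hij => hw (by simp; omega) (by simp; omega) hij)
      (le_iSup_of_le (by simp [hw0, hv0]) (le_iSup_of_le (by simp [hw1]) (le_of_eq ?_)))
    rw [Finset.sum_range]
    exact Finset.sum_congr rfl fun i _ => by simp [edist_comm]
  · refine iSup_le fun n => iSup_le fun s => iSup_le fun hs => iSup_le fun _ => iSup_le fun _ => ?_
    let u : ℕ → unitInterval := fun k => s ⟨min k n, by omega⟩
    have hu : Monotone u := fun i j hij => hs.monotone (by simp; omega)
    refine le_trans (le_of_eq ?_) (eVariationOn.sum_le (f := f) (n := n) hu fun _ => mem_univ _)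
    rw [Finset.sum_range]
    refine Finset.sum_congr rfl fun i _ => ?_
    have h1 : u i = s i.castSucc := by
      exact congrArg s (Fin.ext (by simp; try omega))
    have h2 : u (i + 1) = s i.succ := by
      exact congrArg s (Fin.ext (by simp; try omega))
    rw [h1, h2, edist_comm]

end Partition

/-! ### Chains of the pre-distance -/

section Chains

variable {X : Type*} [MetricSpace X] [MeasurableSpace X] {Y : Set X} {p : ℝ}

theorem dStar_comm {X : Type*} [MetricSpace X] {Y : Set X} (x y : X) :
    dStar Y x y = dStar Y y x := by
  refine iInf_congr fun z => iInf_congr fun _ => ?_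
  rw [edist_comm x z, edist_comm z y, add_comm]

/-- The time reversal of a coupling. -/
noncomputable def ChargedCoupling.swap {σ τ : ChargedProb Y} (q : ChargedCoupling σ τ) :
    ChargedCoupling τ σ where
  pp := q.pp.map Prod.swap
  pm := q.mp.map Prod.swap
  mp := q.pm.map Prod.swap
  mm := q.mm.map Prod.swap
  fst_pos := by simpa using q.snd_pos
  fst_neg := by simpa using q.snd_neg
  snd_pos := by simpa using q.fst_pos
  snd_neg := by simpa using q.fst_neg

theorem ChargedCoupling.cost_swap {σ τ : ChargedProb Y} (q : ChargedCoupling σ τ) :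
    q.swap.cost p = q.cost p := by
  have key : ∀ (κ : Measure (X × X)) (c : X → X → ℝ≥0∞), (∀ x y, c x y = c y x) →
      ∫⁻ z, c z.1 z.2 ^ p ∂(κ.map Prod.swap) = ∫⁻ z, c z.1 z.2 ^ p ∂κ := by
    intro κ c hc
    have := lintegral_map_equiv (μ := κ) (fun z : X × X => c z.1 z.2 ^ p)
      (MeasurableEquiv.prodComm (α := X) (β := X))
    refine this.trans (lintegral_congr fun z => ?_)
    simp [MeasurableEquiv.prodComm, hc z.1 z.2]
  simp only [cost, swap, key _ _ edist_comm, key _ _ (dStar_comm (Y := Y))]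
  ring

theorem Wtilde_comm_le (σ τ : ChargedProb Y) (hp : 0 ≤ p) : Wtilde p τ σ ≤ Wtilde p σ τ := by
  refine ENNReal.rpow_le_rpow (le_iInf fun q => iInf_le_of_le q.swap ?_) (by positivity)
  rw [q.cost_swap]

theorem WZero_comm_le (hp : 0 ≤ p) (μ ν : SubProb Y) : WZero p ν μ ≤ WZero p μ ν := by
  refine le_iInf₂ fun σ τ => le_iInf₂ fun hσ hτ => ?_
  exact iInf₂_le_of_le τ σ (iInf₂_le_of_le hτ hσ (Wtilde_comm_le σ τ hp))

theorem WZero_comm (hp : 0 ≤ p) (μ ν : SubProb Y) : WZero p μ ν = WZero p ν μ :=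
  le_antisymm (WZero_comm_le hp ν μ) (WZero_comm_le hp μ ν)

theorem WFlat_le_sum (n : ℕ) (c : ℕ → SubProbP p Y) :
    WFlat (c 0) (c n) ≤ ∑ i ∈ Finset.range n, WZero p (c i).1 (c (i + 1)).1 := by
  refine iInf₂_le_of_le n (fun i : Fin (n + 1) => c i) (iInf₂_le_of_le (by simp) (by simp) ?_)
  rw [Finset.sum_range]
  simp

/-- Chains in the definition of `WFlat` are easier to concatenate and reverse when they are indexed
by the natural numbers. -/
theorem exists_chain_of_WFlat_lt {μ ν : SubProbP p Y} {r : ℝ≥0∞} (h : WFlat μ ν < r) :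
    ∃ (n : ℕ) (c : ℕ → SubProbP p Y), c 0 = μ ∧ c n = ν ∧
      ∑ i ∈ Finset.range n, WZero p (c i).1 (c (i + 1)).1 < r := by
  simp only [WFlat, iInf_lt_iff] at h
  obtain ⟨n, η, h0, h1, h⟩ := h
  refine ⟨n, fun k => η ⟨min k n, by omega⟩, ?_, ?_, lt_of_eq_of_lt ?_ h⟩
  · rw [← h0]; exact congrArg η (Fin.ext (by simp))
  · rw [← h1]; exact congrArg η (Fin.ext (by simp))
  · rw [Finset.sum_range]
    refine Finset.sum_congr rfl fun i _ => ?_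
    have h1 : (⟨min i n, by omega⟩ : Fin (n + 1)) = i.castSucc := Fin.ext (by simp; try omega)
    have h2 : (⟨min (i + 1) n, by omega⟩ : Fin (n + 1)) = i.succ := Fin.ext (by simp; try omega)
    rw [← h1, ← h2]

theorem WFlat_le_WZero (μ ν : SubProbP p Y) : WFlat μ ν ≤ WZero p μ.1 ν.1 := by
  simpa using WFlat_le_sum 1 fun k => if k = 0 then μ else ν

theorem WFlat_self (μ : SubProbP p Y) : WFlat μ μ = 0 :=
  le_antisymm (by simpa using WFlat_le_sum 0 fun _ => μ) zero_le

theorem WFlat_comm_le (hp : 0 ≤ p) (μ ν : SubProbP p Y) : WFlat ν μ ≤ WFlat μ ν := by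
  refine le_of_forall_gt fun r hr => ?_
  obtain ⟨n, c, rfl, rfl, hc⟩ := exists_chain_of_WFlat_lt hr
  have := WFlat_le_sum n fun k => c (n - k)
  simp only [Nat.sub_zero, Nat.sub_self] at this
  refine this.trans_lt (lt_of_eq_of_lt ?_ hc)
  rw [← Finset.sum_range_reflect]
  refine Finset.sum_congr rfl fun i hi => ?_
  have : i < n := Finset.mem_range.1 hi
  rw [WZero_comm hp, show n - (n - 1 - i + 1) = i by omega, show n - (n - 1 - i) = i + 1 by omega]

theorem WFlat_triangle (μ ν κ : SubProbP p Y) : WFlat μ κ ≤ WFlat μ ν + WFlat ν κ := by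
  rcases eq_or_ne (WFlat μ ν + WFlat ν κ) ∞ with htop | htop
  · rw [htop]; exact le_top
  have hfin := ENNReal.add_ne_top.1 htop
  refine ENNReal.le_of_forall_pos_le_add fun ε hε _ => ?_
  have hε2 : (ε : ℝ≥0∞) / 2 ≠ 0 := by simp [hε.ne']
  obtain ⟨n, c, rfl, hcn, hc⟩ :=
    exists_chain_of_WFlat_lt (ENNReal.lt_add_right hfin.1 hε2)
  obtain ⟨m, c', hc0, rfl, hc'⟩ :=
    exists_chain_of_WFlat_lt (ENNReal.lt_add_right hfin.2 hε2)
  let d : ℕ → SubProbP p Y := fun k => if k ≤ n then c k else c' (k - n)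
  have hd1 : ∀ k ≤ n, d k = c k := fun k hk => by simp [d, hk]
  have hd2 : ∀ k, d (n + k) = c' k := by
    intro k
    rcases Nat.eq_zero_or_pos k with rfl | hk
    · simp [d, hcn, hc0]
    · simp [d, show k ≠ 0 by omega]
  have hchain := WFlat_le_sum (n + m) d
  rw [hd1 0 (Nat.zero_le _), hd2 m, Finset.sum_range_add] at hchain
  refine hchain.trans ?_
  calc _ = ∑ i ∈ Finset.range n, WZero p (c i).1 (c (i + 1)).1
        + ∑ i ∈ Finset.range m, WZero p (c' i).1 (c' (i + 1)).1 := by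
        congr 1
        · refine Finset.sum_congr rfl fun i hi => ?_
          have : i < n := Finset.mem_range.1 hi
          rw [hd1 i this.le, hd1 (i + 1) this]
        · refine Finset.sum_congr rfl fun i _ => ?_
          rw [hd2 i, add_assoc, hd2 (i + 1)]
    _ ≤ (WFlat (c 0) ν + ε / 2) + (WFlat ν (c' m) + ε / 2) := add_le_add hc.le hc'.le
    _ = WFlat (c 0) ν + WFlat ν (c' m) + ε := by
        rw [add_add_add_comm, ENNReal.add_halves]

/-- The space of subprobability measures, endowed with the pseudo-distance `WFlat`. The argument
`hp` is recorded in the type since the symmetry of `WFlat` depends on it. -/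
def FlatSpace (p : ℝ) (Y : Set X) (_ : 1 ≤ p) : Type _ := SubProbP p Y

noncomputable instance {hp : 1 ≤ p} : PseudoEMetricSpace (FlatSpace p Y hp) where
  edist μ ν := WFlat (p := p) (Y := Y) μ ν
  edist_self := WFlat_self
  edist_comm μ ν := le_antisymm (WFlat_comm_le (zero_le_one.trans hp) ν μ)
    (WFlat_comm_le (zero_le_one.trans hp) μ ν)
  edist_triangle := WFlat_triangle

/-- `WSharp` is the length distance of the pseudo-metric `WFlat`. -/
theorem WSharp_eq_lengthEDist {hp : 1 ≤ p} (μ ν : FlatSpace p Y hp) :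
    WSharp (p := p) (Y := Y) μ ν = lengthEDist μ ν := by
  have hlen : ∀ η : unitInterval → SubProbP p Y,
      lengthFlat η = eVariationOn (E := FlatSpace p Y hp) η univ := fun η =>
    (eVariationOn_univ_eq_iSup_partition (M := FlatSpace p Y hp) η).symm
  have hcont : ∀ η : unitInterval → SubProbP p Y,
      ContinuousFlat η ↔ Continuous (Y := FlatSpace p Y hp) η := fun η =>
    ⟨fun h => continuous_iff_continuousAt.2 fun t => tendsto_iff_edist_tendsto_0.2 (h t),
      fun h t => tendsto_iff_edist_tendsto_0.1 (h.tendsto t)⟩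
  refine le_antisymm ?_ ?_
  · refine le_iInf fun γ => ?_
    refine iInf₂_le_of_le (⇑γ : unitInterval → FlatSpace p Y hp) ((hcont _).2 γ.continuous)
      (iInf₂_le_of_le γ.source γ.target (hlen _).le)
  · refine le_iInf₂ fun η hη => le_iInf₂ fun h0 h1 => ?_
    exact iInf_le_of_le (⟨⟨η, (hcont η).1 hη⟩, h0, h1⟩ : Path (X := FlatSpace p Y hp) μ ν)
      (hlen η).ge

theorem WFlat_le_WSharp (hp : 1 ≤ p) (μ ν : SubProbP p Y) : WFlat μ ν ≤ WSharp μ ν := by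
  rw [WSharp_eq_lengthEDist (hp := hp) μ ν]
  exact edist_le_lengthEDist (M := FlatSpace p Y hp) μ ν

theorem WSharp_self (hp : 1 ≤ p) (μ : SubProbP p Y) : WSharp μ μ = 0 :=
  (WSharp_eq_lengthEDist (hp := hp) μ μ).trans (lengthEDist_self _)

theorem WSharp_comm (hp : 1 ≤ p) (μ ν : SubProbP p Y) : WSharp μ ν = WSharp ν μ := by
  rw [WSharp_eq_lengthEDist (hp := hp) μ ν, WSharp_eq_lengthEDist (hp := hp) ν μ]
  exact lengthEDist_comm _ _

theorem WSharp_triangle (hp : 1 ≤ p) (μ ν κ : SubProbP p Y) :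
    WSharp μ κ ≤ WSharp μ ν + WSharp ν κ := by
  rw [WSharp_eq_lengthEDist (hp := hp) μ ν, WSharp_eq_lengthEDist (hp := hp) ν κ,
    WSharp_eq_lengthEDist (hp := hp) μ κ]
  exact lengthEDist_triangle _ _ _

end Chains

/-! ### Restricting probability measures to `Y` -/

section Restriction

variable {X : Type*} [MeasurableSpace X] {Y : Set X}

/-- The restriction to `Y` of a probability measure on `X`. -/
noncomputable def SubProb.restrict (Y : Set X) (ρ : ProbabilityMeasure X) : SubProb Y :=
  ⟨(ρ : Measure X).comap Subtype.val, by
    refine (Measure.comap_apply_le _ _ MeasurableSet.univ.nullMeasurableSet).trans ?_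
    exact prob_le_one⟩

theorem SubProb.ext_restrict (hY : MeasurableSet Y) (ρ : ProbabilityMeasure X) :
    (SubProb.restrict Y ρ).ext = (ρ : Measure X).restrict Y :=
  map_comap_subtype_coe hY _

theorem SubProb.comap_ext (hY : MeasurableSet Y) (μ : SubProb Y) :
    μ.ext.comap Subtype.val = μ.1 :=
  (MeasurableEmbedding.subtype_coe hY).comap_map _

/-- Every subprobability measure on `Y` is the restriction of a probability measure on `X`: put
the missing mass on a point outside `Y`. -/
theorem SubProb.exists_restrict_eq (hY : MeasurableSet Y) {z : X} (hz : z ∉ Y) (μ : SubProb Y) :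
    ∃ ρ : ProbabilityMeasure X, SubProb.restrict Y ρ = μ := by
  have hmass : μ.ext univ = μ.1 univ := by
    rw [SubProb.ext, Measure.map_apply measurable_subtype_coe MeasurableSet.univ, preimage_univ]
  refine ⟨⟨μ.ext + (1 - μ.1 univ) • Measure.dirac z, ⟨?_⟩⟩, Subtype.ext ?_⟩
  · simp [hmass, add_tsub_cancel_of_le μ.2]
  · have hemb := MeasurableEmbedding.subtype_coe hY
    refine Measure.ext fun s hs => ?_
    have hs' : z ∉ ((↑) '' s : Set X) := fun ⟨y, _, hy⟩ => hz (hy ▸ y.2)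
    change (Measure.comap Subtype.val _) s = _
    rw [hemb.comap_apply]
    simp only [ProbabilityMeasure.coe_mk, Measure.coe_add, Measure.coe_smul, Pi.add_apply,
      Pi.smul_apply, smul_eq_mul]
    rw [Measure.dirac_apply' _ (hemb.measurableSet_image.2 hs), indicator_of_notMem hs', mul_zero,
      add_zero, ← hemb.comap_apply, SubProb.comap_ext hY]

/-- A probability measure on `X` as a charged measure: mass outside `Y` is split evenly between
the two charges and mass in `Y` is charged positively. -/
noncomputable def ChargedProb.ofProb (hY : MeasurableSet Y) (ρ : ProbabilityMeasure X) :
    ChargedProb Y where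
  pos := (ρ : Measure X).restrict Y + (2⁻¹ : ℝ≥0∞) • (ρ : Measure X).restrict Yᶜ
  neg := (2⁻¹ : ℝ≥0∞) • (ρ : Measure X).restrict Yᶜ
  restrict_compl := by
    simp [Measure.restrict_restrict hY.compl]
  mass := by
    simp only [Measure.coe_add, Measure.coe_smul, Pi.add_apply, Pi.smul_apply, smul_eq_mul,
      Measure.restrict_apply_univ]
    rw [add_assoc, ← add_mul, ENNReal.inv_two_add_inv_two, one_mul, measure_add_measure_compl hY,
      measure_univ]

theorem ChargedProb.hasEffectiveMeasure_ofProb (hY : MeasurableSet Y) (ρ : ProbabilityMeasure X) :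
    (ChargedProb.ofProb hY ρ).HasEffectiveMeasure (SubProb.restrict Y ρ) := by
  rw [ChargedProb.HasEffectiveMeasure, SubProb.ext_restrict hY]
  exact add_comm _ _

theorem fst_restrict_prod_add (hY : MeasurableSet Y) {A : Set X} (hA : MeasurableSet A)
    (q : Measure (X × X)) :
    (q.restrict (A ×ˢ Y)).fst + (q.restrict (A ×ˢ Yᶜ)).fst = q.fst.restrict A := by
  rw [← Measure.fst_add, ← Measure.restrict_union
    (Disjoint.set_prod_right disjoint_compl_right _ _) (hA.prod hY.compl), ← prod_union,
    union_compl_self, prod_univ, Measure.fst, Measure.fst, Measure.restrict_map measurable_fst hA]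

theorem snd_restrict_prod_add (hY : MeasurableSet Y) {A : Set X} (hA : MeasurableSet A)
    (q : Measure (X × X)) :
    (q.restrict (Y ×ˢ A)).snd + (q.restrict (Yᶜ ×ˢ A)).snd = q.snd.restrict A := by
  rw [← Measure.snd_add, ← Measure.restrict_union
    (Disjoint.set_prod_left disjoint_compl_right _ _) (hY.compl.prod hA), ← union_prod,
    union_compl_self, univ_prod, Measure.snd, Measure.snd, Measure.restrict_map measurable_snd hA]

theorem fst_smul_measure (c : ℝ≥0∞) (q : Measure (X × X)) : (c • q).fst = c • q.fst := by
  simp [Measure.fst, Measure.map_smul]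

theorem snd_smul_measure (c : ℝ≥0∞) (q : Measure (X × X)) : (c • q).snd = c • q.snd := by
  simp [Measure.snd, Measure.map_smul]

theorem inv_two_smul_add_inv_two_smul (κ : Measure X) :
    (2⁻¹ : ℝ≥0∞) • κ + (2⁻¹ : ℝ≥0∞) • κ = κ := by
  rw [← add_smul, ENNReal.inv_two_add_inv_two, one_smul]

/-- A coupling of probability measures on `X` as a coupling of charged measures. Mass moving
inside `Y` stays positive, and mass starting or ending outside `Y` is split evenly. -/
noncomputable def ChargedCoupling.ofCoupling (hY : MeasurableSet Y) {ρ ν : ProbabilityMeasure X}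
    (q : Measure (X × X)) (h1 : q.fst = ρ) (h2 : q.snd = ν) :
    ChargedCoupling (ChargedProb.ofProb hY ρ) (ChargedProb.ofProb hY ν) where
  pp := q.restrict (Y ×ˢ Y) + (2⁻¹ : ℝ≥0∞) • q.restrict (Y ×ˢ Yᶜ) +
    (2⁻¹ : ℝ≥0∞) • q.restrict (Yᶜ ×ˢ Y) + (2⁻¹ : ℝ≥0∞) • q.restrict (Yᶜ ×ˢ Yᶜ)
  pm := (2⁻¹ : ℝ≥0∞) • q.restrict (Y ×ˢ Yᶜ)
  mp := (2⁻¹ : ℝ≥0∞) • q.restrict (Yᶜ ×ˢ Y)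
  mm := (2⁻¹ : ℝ≥0∞) • q.restrict (Yᶜ ×ˢ Yᶜ)
  fst_pos := by
    have hA := fst_restrict_prod_add hY hY q
    have hB := fst_restrict_prod_add hY hY.compl q
    have hb := inv_two_smul_add_inv_two_smul (q.restrict (Y ×ˢ Yᶜ)).fst
    simp only [ChargedProb.ofProb, ← h1, Measure.fst_add, fst_smul_measure]
    rw [← hA, ← hB, smul_add]
    conv_rhs => rw [← hb]
    abel
  fst_neg := by
    have hB := fst_restrict_prod_add hY hY.compl q
    simp only [ChargedProb.ofProb, ← h1, fst_smul_measure]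
    rw [← hB, smul_add]
  snd_pos := by
    have hA := snd_restrict_prod_add hY hY q
    have hB := snd_restrict_prod_add hY hY.compl q
    have hb := inv_two_smul_add_inv_two_smul (q.restrict (Yᶜ ×ˢ Y)).snd
    simp only [ChargedProb.ofProb, ← h2, Measure.snd_add, snd_smul_measure]
    rw [← hA, ← hB, smul_add]
    conv_rhs => rw [← hb]
    abel
  snd_neg := by
    have hB := snd_restrict_prod_add hY hY.compl q
    simp only [ChargedProb.ofProb, ← h2, snd_smul_measure]
    rw [← hB, smul_add]

end Restriction

section UpperBound

variable {X : Type*} [MetricSpace X] [MeasurableSpace X] {Y : Set X} {p : ℝ}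

theorem dStar_le_edist {X : Type*} [MetricSpace X] {Y : Set X} {x y : X} (h : x ∉ Y ∨ y ∉ Y) :
    dStar Y x y ≤ edist x y := by
  rcases h with h | h
  · exact iInf₂_le_of_le x h (by simp)
  · exact iInf₂_le_of_le y h (by simp)

theorem ChargedCoupling.cost_ofCoupling_le (hY : MeasurableSet Y) (hp : 0 ≤ p)
    {ρ ν : ProbabilityMeasure X} (q : Measure (X × X)) (h1 : q.fst = ρ) (h2 : q.snd = ν) :
    (ChargedCoupling.ofCoupling hY q h1 h2).cost p ≤ ∫⁻ z, edist z.1 z.2 ^ p ∂q := by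
  have hstar : ∀ S : Set (X × X), MeasurableSet S → (∀ z ∈ S, z.1 ∉ Y ∨ z.2 ∉ Y) →
      ∫⁻ z in S, dStar Y z.1 z.2 ^ p ∂q ≤ ∫⁻ z in S, edist z.1 z.2 ^ p ∂q := fun S hS h =>
    setLIntegral_mono' hS fun z hz => ENNReal.rpow_le_rpow (dStar_le_edist (h z hz)) hp
  have h12 := hstar (Y ×ˢ Yᶜ) (hY.prod hY.compl) fun z hz => Or.inr hz.2
  have h21 := hstar (Yᶜ ×ˢ Y) (hY.compl.prod hY) fun z hz => Or.inl hz.1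
  have hsplit : ∫⁻ z, edist z.1 z.2 ^ p ∂q
      = ∫⁻ z in Y ×ˢ Y, edist z.1 z.2 ^ p ∂q + ∫⁻ z in Y ×ˢ Yᶜ, edist z.1 z.2 ^ p ∂q
        + (∫⁻ z in Yᶜ ×ˢ Y, edist z.1 z.2 ^ p ∂q
          + ∫⁻ z in Yᶜ ×ˢ Yᶜ, edist z.1 z.2 ^ p ∂q) := by
    rw [← lintegral_union (hY.prod hY.compl) (Disjoint.set_prod_right disjoint_compl_right _ _),
      ← lintegral_union (hY.compl.prod hY.compl)
        (Disjoint.set_prod_right disjoint_compl_right _ _), ← prod_union, ← prod_union,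
      union_compl_self, prod_univ, prod_univ, preimage_compl,
      lintegral_add_compl _ (measurable_fst hY)]
  have hhalf : ∀ a : ℝ≥0∞, 2⁻¹ * a + 2⁻¹ * a = a := fun a => by
    rw [← add_mul, ENNReal.inv_two_add_inv_two, one_mul]
  simp only [cost, ofCoupling, lintegral_add_measure, lintegral_smul_measure, smul_eq_mul]
  rw [hsplit]
  set a := ∫⁻ z in Y ×ˢ Y, edist z.1 z.2 ^ p ∂q
  set b := ∫⁻ z in Y ×ˢ Yᶜ, edist z.1 z.2 ^ p ∂q
  set c := ∫⁻ z in Yᶜ ×ˢ Y, edist z.1 z.2 ^ p ∂q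
  set d := ∫⁻ z in Yᶜ ×ˢ Yᶜ, edist z.1 z.2 ^ p ∂q
  calc _ ≤ a + 2⁻¹ * b + 2⁻¹ * c + 2⁻¹ * d + 2⁻¹ * b + 2⁻¹ * c + 2⁻¹ * d := by gcongr
    _ = a + (2⁻¹ * b + 2⁻¹ * b) + ((2⁻¹ * c + 2⁻¹ * c) + (2⁻¹ * d + 2⁻¹ * d)) := by ring
    _ = a + b + (c + d) := by simp only [hhalf]

/-- The pre-distance of restrictions to `Y` is bounded by the transport cost on `X`. -/
theorem WZero_restrict_le (hY : MeasurableSet Y) (hp : 0 ≤ p) {ρ ν : ProbabilityMeasure X}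
    (q : Measure (X × X)) (h1 : q.fst = ρ) (h2 : q.snd = ν) :
    WZero p (SubProb.restrict Y ρ) (SubProb.restrict Y ν)
      ≤ (∫⁻ z, edist z.1 z.2 ^ p ∂q) ^ (1 / p) := by
  refine iInf₂_le_of_le (ChargedProb.ofProb hY ρ) (ChargedProb.ofProb hY ν)
    (iInf₂_le_of_le (ChargedProb.hasEffectiveMeasure_ofProb hY ρ)
      (ChargedProb.hasEffectiveMeasure_ofProb hY ν) ?_)
  exact ENNReal.rpow_le_rpow (iInf_le_of_le (ChargedCoupling.ofCoupling hY q h1 h2)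
    (ChargedCoupling.cost_ofCoupling_le hY hp q h1 h2)) (by positivity)

theorem lintegral_edist_rpow_lt_top [CompactSpace X] (hp : 0 ≤ p) (q : Measure (X × X))
    [IsFiniteMeasure q] : ∫⁻ z, edist z.1 z.2 ^ p ∂q < ∞ := by
  have hdiam : Metric.ediam (univ : Set X) ≠ ∞ := isCompact_univ.isBounded.ediam_ne_top
  refine (lintegral_mono fun z : X × X => ENNReal.rpow_le_rpow
    (Metric.edist_le_ediam_of_mem (mem_univ z.1) (mem_univ z.2)) hp).trans_lt ?_
  rw [lintegral_const]
  exact ENNReal.mul_lt_top (ENNReal.rpow_lt_top_of_nonneg hp hdiam) (measure_lt_top _ _)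

theorem WZero_lt_top [CompactSpace X] (hY : MeasurableSet Y) (hne : Y ≠ univ) (hp : 0 ≤ p)
    (μ ν : SubProb Y) : WZero p μ ν < ∞ := by
  obtain ⟨z, hz⟩ := (ne_univ_iff_exists_notMem Y).1 hne
  obtain ⟨ρ, rfl⟩ := SubProb.exists_restrict_eq hY hz μ
  obtain ⟨σ, rfl⟩ := SubProb.exists_restrict_eq hY hz ν
  refine (WZero_restrict_le hY hp ((ρ : Measure X).prod σ) (by simp) (by simp)).trans_lt ?_
  exact ENNReal.rpow_lt_top_of_nonneg (by positivity) (lintegral_edist_rpow_lt_top hp _).ne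

/-- The restriction to `Y` of a probability measure on `X`, as an element of `SubProbP p Y`: on a
compact space all pre-distances are finite. -/
noncomputable def SubProbP.restrict [CompactSpace X] (hY : MeasurableSet Y) (hnonempty : Y.Nonempty)
    (hne : Y ≠ univ) (hp : 0 ≤ p) (ρ : ProbabilityMeasure X) : SubProbP p Y :=
  ⟨SubProb.restrict Y ρ, ⟨_, hnonempty.some_mem⟩, WZero_lt_top hY hne hp _ _⟩

theorem SubProbP.restrict_surjective [CompactSpace X] (hY : MeasurableSet Y)
    (hnonempty : Y.Nonempty) (hne : Y ≠ univ) (hp : 0 ≤ p) :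
    Function.Surjective (SubProbP.restrict hY hnonempty hne hp) := by
  obtain ⟨z, hz⟩ := (ne_univ_iff_exists_notMem Y).1 hne
  intro μ
  obtain ⟨ρ, hρ⟩ := SubProb.exists_restrict_eq hY hz μ.1
  exact ⟨ρ, Subtype.ext hρ⟩

end UpperBound

/-! ### Displacement interpolation in a compact geodesic space -/

section Interpolation

variable {X : Type*} [MetricSpace X] [MeasurableSpace X] [BorelSpace X] [CompactSpace X]

/-- The cost function `d ^ p`, as a bounded continuous function on a compact space. -/
noncomputable def costFunction (X : Type*) [MetricSpace X] [CompactSpace X] (p : ℝ) (hp : 0 ≤ p) :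
    BoundedContinuousFunction (X × X) NNReal :=
  BoundedContinuousFunction.mkOfCompact
    ⟨fun z => nndist z.1 z.2 ^ p, by
      exact (NNReal.continuous_rpow_const hp).comp continuous_nndist⟩

theorem coe_costFunction {X : Type*} [MetricSpace X] [CompactSpace X] {p : ℝ} (hp : 0 ≤ p)
    (z : X × X) :
    (costFunction X p hp z : ℝ≥0∞) = edist z.1 z.2 ^ p := by
  change ((nndist z.1 z.2 ^ p : NNReal) : ℝ≥0∞) = _
  rw [edist_nndist, ENNReal.coe_rpow_of_nonneg _ hp]

/-- Couplings between the endpoints interpolate: there is a curve of probability measures, any two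
of which admit a coupling whose cost is the corresponding fraction of the given cost. To avoid
choosing geodesics measurably in their endpoints, the endpoints are first approximated by points of
finite sets, and the curves obtained in this way converge along a filter since the space of
probability measures is compact. -/
theorem exists_interpolation (hX : IsGeodesicSpace X) {p : ℝ} (hp : 0 ≤ p)
    (q : ProbabilityMeasure (X × X)) :
    ∃ ρ : unitInterval → ProbabilityMeasure X, (ρ 0 : Measure X) = (q : Measure (X × X)).fst ∧
      (ρ 1 : Measure X) = (q : Measure (X × X)).snd ∧
      ∀ s t : unitInterval, ∃ Q : Measure (X × X), Q.fst = ρ s ∧ Q.snd = ρ t ∧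
        ∫⁻ z, edist z.1 z.2 ^ p ∂Q
          ≤ ENNReal.ofReal |(s : ℝ) - t| ^ p * ∫⁻ z, edist z.1 z.2 ^ p ∂(q : Measure (X × X)) := by
  have : Nonempty (X × X) := q.nonempty
  obtain ⟨x₀, -⟩ := this
  choose γ hγ0 hγ1 hγ using hX
  let π : ℕ → SimpleFunc X X := SimpleFunc.approxOn id measurable_id univ x₀ (mem_univ _)
  have hπ : ∀ x, Tendsto (fun n => π n x) atTop (𝓝 x) := fun x =>
    SimpleFunc.tendsto_approxOn measurable_id (mem_univ x₀) (by simp)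
  let D : ℕ → SimpleFunc (X × X) (X × X) := fun n =>
    ((π n).comp Prod.fst measurable_fst).pair ((π n).comp Prod.snd measurable_snd)
  have hD : ∀ n z, D n z = (π n z.1, π n z.2) := fun n z => rfl
  let G : ℕ → unitInterval → X × X → X := fun n t z => γ (π n z.1) (π n z.2) t
  have hG : ∀ n t, Measurable (G n t) := fun n t =>
    ((D n).map fun w : X × X => γ w.1 w.2 t).measurable
  let L : ℕ → unitInterval → unitInterval → ProbabilityMeasure (X × X) := fun n s t =>
    q.map ((hG n s).prodMk (hG n t)).aemeasurable
  let R : ℕ → unitInterval → ProbabilityMeasure X := fun n t => q.map (hG n t).aemeasurable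
  let U : Ultrafilter ℕ := hyperfilter ℕ
  have hU : (U : Filter ℕ) ≤ atTop := Nat.hyperfilter_le_atTop
  have hlimL : ∀ s t, ∃ Q, Tendsto (fun n => L n s t) U (𝓝 Q) := fun s t => by
    obtain ⟨Q, -, hQ⟩ := isCompact_univ.ultrafilter_le_nhds (U.map fun n => L n s t) (by simp)
    exact ⟨Q, hQ⟩
  have hlimR : ∀ t, ∃ ρ, Tendsto (fun n => R n t) U (𝓝 ρ) := fun t => by
    obtain ⟨ρ, -, hρ⟩ := isCompact_univ.ultrafilter_le_nhds (U.map fun n => R n t) (by simp)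
    exact ⟨ρ, hρ⟩
  choose Q hQ using hlimL
  choose ρ hρ using hlimR
  have hend : ∀ (f : X × X → X) (hf : Measurable f) (t : unitInterval),
      (∀ z, Tendsto (fun n => G n t z) atTop (𝓝 (f z))) → ρ t = q.map hf.aemeasurable := by
    intro f hf t h
    refine tendsto_nhds_unique (hρ t) (Tendsto.mono_left ?_ hU)
    exact (tendstoInDistribution_of_ae_tendsto (μ' := (q : Measure (X × X)))
      (fun n => (hG n t).aemeasurable) hf.aemeasurable (ae_of_all _ h)).tendsto
  refine ⟨ρ, ?_, ?_, fun s t => ⟨Q s t, ?_, ?_, ?_⟩⟩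
  · rw [hend Prod.fst measurable_fst 0 fun z => by simpa [G, hγ0] using hπ z.1]
    rfl
  · rw [hend Prod.snd measurable_snd 1 fun z => by simpa [G, hγ1] using hπ z.2]
    rfl
  · have h1 : (Q s t).map continuous_fst.aemeasurable = ρ s := by
      refine tendsto_nhds_unique ?_ (hρ s)
      refine (ProbabilityMeasure.tendsto_map_of_tendsto_of_continuous _ _ (hQ s t)
        continuous_fst).congr fun n => Subtype.ext ?_
      exact Measure.map_map measurable_fst ((hG n s).prodMk (hG n t))
    rw [← h1]; rfl
  · have h1 : (Q s t).map continuous_snd.aemeasurable = ρ t := by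
      refine tendsto_nhds_unique ?_ (hρ t)
      refine (ProbabilityMeasure.tendsto_map_of_tendsto_of_continuous _ _ (hQ s t)
        continuous_snd).congr fun n => Subtype.ext ?_
      exact Measure.map_map measurable_snd ((hG n s).prodMk (hG n t))
    rw [← h1]; rfl
  · have hc := fun κ : Measure (X × X) => lintegral_congr (μ := κ) fun z =>
      (coe_costFunction (X := X) hp z).symm
    rw [hc, hc]
    have h1 := ProbabilityMeasure.tendsto_iff_forall_lintegral_tendsto.1 (hQ s t)
      (costFunction X p hp)
    have h2 : Tendsto (fun n => ∫⁻ z, costFunction X p hp (D n z) ∂(q : Measure (X × X))) U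
        (𝓝 (∫⁻ z, costFunction X p hp z ∂(q : Measure (X × X)))) := by
      have h3 := (tendstoInDistribution_of_ae_tendsto (μ' := (q : Measure (X × X)))
        (X := fun n => (D n : X × X → X × X)) (l := atTop) (Z := id)
        (fun n => (D n).measurable.aemeasurable) aemeasurable_id
        (ae_of_all _ fun z => (hπ z.1).prodMk_nhds (hπ z.2))).tendsto
      have h4 := (ProbabilityMeasure.tendsto_iff_forall_lintegral_tendsto.1 h3
        (costFunction X p hp)).mono_left hU
      simp only [ProbabilityMeasure.coe_mk, Measure.map_id] at h4
      refine h4.congr fun n => ?_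
      exact lintegral_map (by fun_prop) (D n).measurable
    have hne : ENNReal.ofReal |(s : ℝ) - t| ^ p ≠ ∞ :=
      (ENNReal.rpow_lt_top_of_nonneg hp ENNReal.ofReal_ne_top).ne
    refine le_of_tendsto_of_tendsto' h1 (ENNReal.Tendsto.const_mul h2 (Or.inr hne)) fun n => ?_
    rw [← lintegral_const_mul' _ _ hne]
    refine (lintegral_map (by fun_prop) ((hG n s).prodMk (hG n t))).trans_le ?_
    refine lintegral_mono fun z => le_of_eq ?_
    simp only [coe_costFunction, G, hD]
    rw [edist_dist, hγ, ENNReal.ofReal_mul (abs_nonneg _), ← edist_dist,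
      ENNReal.mul_rpow_of_nonneg _ _ hp]

end Interpolation

/-! ### Comparison with the transport cost -/

section Sharp

variable {X : Type*} [MetricSpace X] [MeasurableSpace X] [BorelSpace X] [CompactSpace X]
  {Y : Set X} {p : ℝ}

/-- The transportation-annihilation distance of restrictions to `Y` is bounded by the transport
cost on `X`. -/
theorem WSharp_restrict_le (hX : IsGeodesicSpace X) (hY : MeasurableSet Y)
    (hnonempty : Y.Nonempty) (hne : Y ≠ univ) (hp : 1 ≤ p) (hp' : 0 ≤ p)
    {ρ ν : ProbabilityMeasure X}
    (q : Measure (X × X)) (h1 : q.fst = ρ) (h2 : q.snd = ν) :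
    WSharp (SubProbP.restrict hY hnonempty hne hp' ρ) (SubProbP.restrict hY hnonempty hne hp' ν)
      ≤ (∫⁻ z, edist z.1 z.2 ^ p ∂q) ^ (1 / p) := by
  have hq : IsProbabilityMeasure q := ⟨by rw [← Measure.fst_univ, h1, measure_univ]⟩
  have hp0 : p ≠ 0 := (zero_lt_one.trans_le hp).ne'
  obtain ⟨η, hη0, hη1, hη⟩ := exists_interpolation hX hp' ⟨q, hq⟩
  obtain rfl : η 0 = ρ := Subtype.ext (hη0.trans h1)
  obtain rfl : η 1 = ν := Subtype.ext (hη1.trans h2)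
  have hfin : (∫⁻ z, edist z.1 z.2 ^ p ∂q) ^ (1 / p) ≠ ∞ :=
    (ENNReal.rpow_lt_top_of_nonneg (by positivity) (lintegral_edist_rpow_lt_top hp' _).ne).ne
  lift (∫⁻ z, edist z.1 z.2 ^ p ∂q) ^ (1 / p) to NNReal using hfin with K hK
  let f : unitInterval → FlatSpace p Y hp := fun t => SubProbP.restrict hY hnonempty hne hp' (η t)
  refine (WSharp_eq_lengthEDist (f 0) (f 1)).trans_le (lengthEDist_le_of_lipschitzWith ?_)
  intro s t
  obtain ⟨Q, hQs, hQt, hQ⟩ := hη s t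
  refine (WFlat_le_WZero _ _).trans ((WZero_restrict_le hY hp' Q hQs hQt).trans ?_)
  refine (ENNReal.rpow_le_rpow hQ (by positivity)).trans (le_of_eq ?_)
  rw [ENNReal.mul_rpow_of_nonneg _ _ (by positivity), ← ENNReal.rpow_mul, mul_one_div_cancel hp0,
    ENNReal.rpow_one, ProbabilityMeasure.coe_mk, ← hK,
    mul_comm, Subtype.edist_eq, edist_dist, Real.dist_eq]

end Sharp

/-! ### Transport cost and weak convergence -/

section Weak

variable {X : Type*} [MetricSpace X] [MeasurableSpace X] [BorelSpace X]

/-- A coupling of two discrete measures on the same points that leaves the common mass in place. -/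
theorem exists_coupling_discrete [SecondCountableTopology X] {ι : Type*} [Fintype ι] {p : ℝ}
    (hp : 0 < p) (x : ι → X) (a b : ι → ℝ≥0∞) (ha : ∑ i, a i = 1) (hb : ∑ i, b i = 1) {C : ℝ≥0∞}
    (hC : ∀ x y : X, edist x y ≤ C) :
    ∃ q : Measure (X × X), q.fst = ∑ i, a i • Measure.dirac (x i) ∧
      q.snd = ∑ i, b i • Measure.dirac (x i) ∧
      ∫⁻ z, edist z.1 z.2 ^ p ∂q ≤ C ^ p * ∑ i, (a i - b i) := by
  set θ := ∑ i, (a i - b i) with hθ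
  have ha' : ∀ i, a i = min (a i) (b i) + (a i - b i) := fun i => by
    rcases le_total (a i) (b i) with h | h
    · rw [min_eq_left h, tsub_eq_zero_of_le h, add_zero]
    · rw [min_eq_right h, add_tsub_cancel_of_le h]
  have hb' : ∀ i, b i = min (a i) (b i) + (b i - a i) := fun i => by
    rcases le_total (a i) (b i) with h | h
    · rw [min_eq_left h, add_tsub_cancel_of_le h]
    · rw [min_eq_right h, tsub_eq_zero_of_le h, add_zero]
  have hminle : ∑ i, min (a i) (b i) ≤ 1 := ha ▸ Finset.sum_le_sum fun i _ => min_le_left _ _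
  have hmin : ∑ i, min (a i) (b i) ≠ ∞ := (hminle.trans_lt ENNReal.one_lt_top).ne
  have hsuma : ∑ i, min (a i) (b i) + θ = 1 := by
    rw [← ha, hθ, ← Finset.sum_add_distrib]
    exact Finset.sum_congr rfl fun i _ => (ha' i).symm
  have hsumb : ∑ i, min (a i) (b i) + ∑ i, (b i - a i) = 1 := by
    rw [← hb, ← Finset.sum_add_distrib]
    exact Finset.sum_congr rfl fun i _ => (hb' i).symm
  have hθ' : ∑ i, (b i - a i) = θ := (ENNReal.add_right_inj hmin).1 (hsumb.trans hsuma.symm)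
  have hθtop : θ ≠ ∞ := ((le_add_self.trans hsuma.le).trans_lt ENNReal.one_lt_top).ne
  let α : Measure X := ∑ i, (a i - b i) • Measure.dirac (x i)
  let β : Measure X := ∑ i, (b i - a i) • Measure.dirac (x i)
  have hα : α univ = θ := by simp [α, hθ]
  have hβ : β univ = θ := by simp [β, hθ']
  have hαf : IsFiniteMeasure α := ⟨by rw [hα]; exact hθtop.lt_top⟩
  have hβf : IsFiniteMeasure β := ⟨by rw [hβ]; exact hθtop.lt_top⟩
  have hscale : ∀ κ : Measure X, κ univ = θ → (θ⁻¹ * θ) • κ = κ := by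
    intro κ hκ
    -- If no mass remains, then `θ⁻¹ = ∞`, but the measures to be scaled vanish.
    rcases eq_or_ne θ 0 with h0 | h0
    · have : κ = 0 := Measure.measure_univ_eq_zero.1 (hκ.trans h0)
      simp [this]
    · rw [ENNReal.inv_mul_cancel h0 hθtop, one_smul]
  have hdiag : ∀ f : X × X → X, Measurable f → (∀ y, f (y, y) = y) →
      (∑ i, min (a i) (b i) • Measure.dirac (x i, x i)).map f
        = ∑ i, min (a i) (b i) • Measure.dirac (x i) := by
    intro f hf h
    rw [← Measure.mapₗ_apply_of_measurable hf, map_sum]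
    refine Finset.sum_congr rfl fun i _ => ?_
    rw [map_smul, Measure.mapₗ_apply_of_measurable hf, Measure.map_dirac' hf, h]
  refine ⟨∑ i, min (a i) (b i) • Measure.dirac (x i, x i) + θ⁻¹ • α.prod β, ?_, ?_, ?_⟩
  · rw [Measure.fst_add, fst_smul_measure, Measure.fst, hdiag _ measurable_fst fun _ => rfl,
      Measure.fst, Measure.map_fst_prod, hβ, smul_smul, hscale α hα, ← Finset.sum_add_distrib]
    refine Finset.sum_congr rfl fun i _ => ?_
    rw [← add_smul, ← ha' i]
  · rw [Measure.snd_add, snd_smul_measure, Measure.snd, hdiag _ measurable_snd fun _ => rfl,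
      Measure.snd, Measure.map_snd_prod, hα, smul_smul, hscale β hβ, ← Finset.sum_add_distrib]
    refine Finset.sum_congr rfl fun i _ => ?_
    rw [← add_smul, ← hb' i]
  · have h0 : ∫⁻ z, edist z.1 z.2 ^ p ∂(∑ i, min (a i) (b i) • Measure.dirac (x i, x i)) = 0 := by
      rw [lintegral_finsetSum_measure]
      refine Finset.sum_eq_zero fun i _ => ?_
      rw [lintegral_smul_measure, lintegral_dirac' _ (by fun_prop)]
      simp [hp]
    rw [lintegral_add_measure, h0, zero_add, lintegral_smul_measure]
    calc θ⁻¹ • ∫⁻ z, edist z.1 z.2 ^ p ∂α.prod β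
        ≤ θ⁻¹ • ∫⁻ _, C ^ p ∂α.prod β := by
          refine mul_le_mul_right (lintegral_mono fun z => ?_) _
          exact ENNReal.rpow_le_rpow (hC _ _) hp.le
      _ = C ^ p * (θ⁻¹ * θ * θ) := by
          rw [lintegral_const, ← univ_prod_univ, Measure.prod_prod, hα, hβ, smul_eq_mul]
          ring
      _ ≤ C ^ p * θ := by
          gcongr
          exact mul_le_of_le_one_left zero_le (ENNReal.inv_mul_le_one _)

/-- Probability measures on a compact space can be transported at small cost to a fixed finite set,
in such a way that the mass of each point depends continuously on the measure. -/
theorem exists_discretization [CompactSpace X] {p : ℝ} (hp : 0 ≤ p) {ε : ℝ} (hε : 0 < ε) :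
    ∃ (n : ℕ) (x : Fin n → X) (φ : Fin n → BoundedContinuousFunction X NNReal),
      ∀ ρ : ProbabilityMeasure X, ∑ i, ∫⁻ y, φ i y ∂(ρ : Measure X) = 1 ∧
        ∃ q : Measure (X × X), q.fst = ρ ∧
          q.snd = ∑ i, (∫⁻ y, φ i y ∂(ρ : Measure X)) • Measure.dirac (x i) ∧
          ∫⁻ z, edist z.1 z.2 ^ p ∂q ≤ ENNReal.ofReal ε ^ p := by
  obtain ⟨t, -, ht⟩ := isCompact_univ.elim_nhds_subcover (fun x : X => Metric.ball x ε)
    fun x _ => Metric.ball_mem_nhds x hε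
  let x : Fin t.card → X := fun i => (t.equivFin.symm i : X)
  -- The plan is given by a partition of unity subordinate to a cover by balls of radius `ε`.
  let ψ : Fin t.card → X → NNReal := fun i y => Real.toNNReal (ε - dist y (x i))
  have hψc : ∀ i, Continuous (ψ i) := fun i => by fun_prop
  have hψ : ∀ y, ∑ i, ψ i y ≠ 0 := by
    intro y h
    obtain ⟨c, hc, hy⟩ := mem_iUnion₂.1 (ht (mem_univ y))
    have h1 := (Finset.sum_eq_zero_iff.1 h) (t.equivFin ⟨c, hc⟩) (Finset.mem_univ _)
    simp only [ψ, x, Equiv.symm_apply_apply, Real.toNNReal_eq_zero] at h1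
    have := Metric.mem_ball.1 hy
    linarith
  let φ : Fin t.card → BoundedContinuousFunction X NNReal := fun i =>
    BoundedContinuousFunction.mkOfCompact ⟨fun y => ψ i y / ∑ j, ψ j y,
      (hψc i).div₀ (continuous_finsetSum _ fun j _ => hψc j) hψ⟩
  have hφ : ∀ i y, φ i y = ψ i y / ∑ j, ψ j y := fun i y => rfl
  have hφm : ∀ i, Measurable fun y => (φ i y : ℝ≥0∞) := fun i => by fun_prop
  have hφ1 : ∀ y, ∑ i, (φ i y : ℝ≥0∞) = 1 := by
    intro y
    rw [← ENNReal.ofNNReal_finsetSum]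
    simp only [hφ]
    rw [← Finset.sum_div, div_self (hψ y), ENNReal.coe_one]
  have hfar : ∀ i y, ε ≤ dist y (x i) → φ i y = 0 := by
    intro i y h
    simp [hφ, ψ, Real.toNNReal_of_nonpos (sub_nonpos.2 h)]
  refine ⟨t.card, x, φ, fun ρ => ?_⟩
  have hsum : ∀ f : X → ℝ≥0∞, Measurable f →
      ∑ i, ∫⁻ y, φ i y * f y ∂(ρ : Measure X) = ∫⁻ y, f y ∂(ρ : Measure X) := by
    intro f hf
    refine (lintegral_finsetSum _ fun i _ => (hφm i).mul hf).symm.trans ?_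
    refine lintegral_congr fun y => ?_
    simp_rw [Pi.mul_apply, ← Finset.sum_mul, hφ1, one_mul]
  have hone : ∑ i, ∫⁻ y, φ i y ∂(ρ : Measure X) = 1 := by
    simpa using hsum (fun _ => 1) measurable_const
  have hmk : ∀ i, Measurable fun y : X => (y, x i) := fun i => by fun_prop
  let w : Fin t.card → Measure X := fun i => (ρ : Measure X).withDensity fun y => φ i y
  have hint : ∀ f : X × X → ℝ≥0∞, Measurable f →
      ∫⁻ z, f z ∂(∑ i, (w i).map fun y => (y, x i))
        = ∑ i, ∫⁻ y, φ i y * f (y, x i) ∂(ρ : Measure X) := by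
    intro f hf
    rw [lintegral_finsetSum_measure]
    refine Finset.sum_congr rfl fun i _ => ?_
    rw [lintegral_map hf (hmk i)]
    exact lintegral_withDensity_eq_lintegral_mul _ (hφm i) (hf.comp (hmk i))
  refine ⟨hone, ∑ i, (w i).map fun y => (y, x i), ?_, ?_, ?_⟩
  · refine Measure.ext fun s hs => ?_
    rw [Measure.fst_apply hs, ← lintegral_indicator_one (measurable_fst hs),
      hint _ (measurable_one.indicator (measurable_fst hs)), ← lintegral_indicator_one hs,
      ← hsum _ (measurable_one.indicator hs)]
    rfl
  · refine Measure.ext fun s hs => ?_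
    rw [Measure.snd_apply hs, ← lintegral_indicator_one (measurable_snd hs),
      hint _ (measurable_one.indicator (measurable_snd hs)), Measure.finsetSum_apply]
    refine Finset.sum_congr rfl fun i _ => ?_
    rw [Measure.smul_apply, Measure.dirac_apply' _ hs, smul_eq_mul]
    exact lintegral_mul_const (s.indicator 1 (x i)) (hφm i)
  · rw [hint _ (by fun_prop)]
    calc ∑ i, ∫⁻ y, φ i y * edist y (x i) ^ p ∂(ρ : Measure X)
        ≤ ∑ i, ∫⁻ y, φ i y * ENNReal.ofReal ε ^ p ∂(ρ : Measure X) := by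
          refine Finset.sum_le_sum fun i _ => lintegral_mono fun y => ?_
          rcases le_total ε (dist y (x i)) with h | h
          · simp [hfar i y h]
          · gcongr
            rw [edist_dist]
            exact ENNReal.ofReal_le_ofReal h
      _ = ENNReal.ofReal ε ^ p := by
          rw [hsum _ measurable_const]
          simp

variable [CompactSpace X] {Y : Set X} {p : ℝ}

/-- Restriction to `Y` is continuous from the weak topology to the transportation-annihilation
distance. -/
theorem tendsto_WSharp_restrict (hX : IsGeodesicSpace X) (hY : MeasurableSet Y)
    (hnonempty : Y.Nonempty) (hne : Y ≠ univ) (hp : 1 ≤ p) (hp' : 0 ≤ p)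
    (ρ : ProbabilityMeasure X) :
    Tendsto (fun σ => WSharp (SubProbP.restrict hY hnonempty hne hp' σ)
      (SubProbP.restrict hY hnonempty hne hp' ρ)) (𝓝 ρ) (𝓝 0) := by
  have hp0 : 0 < p := zero_lt_one.trans_le hp
  set Φ := SubProbP.restrict (p := p) hY hnonempty hne hp' with hΦ
  have hroot : ∀ a : ℝ≥0∞, (a ^ p) ^ (1 / p) = a := fun a => by
    rw [← ENNReal.rpow_mul, mul_one_div_cancel hp0.ne', ENNReal.rpow_one]
  have hle : ∀ {σ ν : ProbabilityMeasure X} (q : Measure (X × X)) (ε : ℝ≥0∞), q.fst = σ →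
      q.snd = ν → ∫⁻ z, edist z.1 z.2 ^ p ∂q ≤ ε ^ p → WSharp (Φ σ) (Φ ν) ≤ ε := by
    intro σ ν q ε h1 h2 h
    refine (WSharp_restrict_le hX hY hnonempty hne hp hp' q h1 h2).trans ?_
    exact (ENNReal.rpow_le_rpow h (by positivity)).trans (hroot ε).le
  have hdiam : Metric.ediam (univ : Set X) ≠ ∞ := isCompact_univ.isBounded.ediam_ne_top
  refine ENNReal.tendsto_nhds_zero.2 fun δ hδ => ?_
  obtain ⟨ε, hε, hεδ⟩ : ∃ ε : ℝ, 0 < ε ∧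
      ENNReal.ofReal ε + ENNReal.ofReal ε + ENNReal.ofReal ε ≤ δ := by
    rcases eq_or_ne δ ∞ with rfl | hδt
    · exact ⟨1, one_pos, le_top⟩
    · have hpos : 0 < δ.toReal := ENNReal.toReal_pos hδ.ne' hδt
      refine ⟨δ.toReal / 3, by positivity, ?_⟩
      rw [← ENNReal.ofReal_add (by positivity) (by positivity),
        ← ENNReal.ofReal_add (by positivity) (by positivity)]
      exact ENNReal.ofReal_le_of_le_toReal (by linarith)
  obtain ⟨n, x, φ, hφ⟩ := exists_discretization (X := X) hp' hε
  have hsmall : ∀ᶠ σ : ProbabilityMeasure X in 𝓝 ρ, Metric.ediam (univ : Set X) ^ p *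
      ∑ i, ((∫⁻ y, φ i y ∂(σ : Measure X)) - ∫⁻ y, φ i y ∂(ρ : Measure X))
        ≤ ENNReal.ofReal ε ^ p := by
    have hfin : ∀ i, ∫⁻ y, φ i y ∂(ρ : Measure X) ≠ ∞ := fun i =>
      ((Finset.single_le_sum (f := fun i => ∫⁻ y, φ i y ∂(ρ : Measure X)) (fun _ _ => zero_le)
        (Finset.mem_univ i)).trans_lt ((hφ ρ).1.trans_lt ENNReal.one_lt_top)).ne
    have hlim : Tendsto (fun σ : ProbabilityMeasure X => Metric.ediam (univ : Set X) ^ p *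
        ∑ i, ((∫⁻ y, φ i y ∂(σ : Measure X)) - ∫⁻ y, φ i y ∂(ρ : Measure X))) (𝓝 ρ) (𝓝 0) := by
      rw [show (0 : ℝ≥0∞) = Metric.ediam (univ : Set X) ^ p * ∑ i : Fin n,
        ((∫⁻ y, φ i y ∂(ρ : Measure X)) - ∫⁻ y, φ i y ∂(ρ : Measure X)) by simp]
      refine ENNReal.Tendsto.const_mul (tendsto_finsetSum _ fun i _ => ?_)
        (Or.inr (ENNReal.rpow_lt_top_of_nonneg hp' hdiam).ne)
      exact ENNReal.Tendsto.sub
        (ProbabilityMeasure.tendsto_iff_forall_lintegral_tendsto.1 tendsto_id (φ i))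
        tendsto_const_nhds (Or.inl (hfin i))
    have hpos : 0 < ENNReal.ofReal ε ^ p :=
      ENNReal.rpow_pos (ENNReal.ofReal_pos.2 hε) ENNReal.ofReal_ne_top
    exact (hlim.eventually (gt_mem_nhds hpos)).mono fun _ h => h.le
  filter_upwards [hsmall] with σ hσ
  obtain ⟨hσ1, qσ, hqσ1, hqσ2, hqσ⟩ := hφ σ
  obtain ⟨hρ1, qρ, hqρ1, hqρ2, hqρ⟩ := hφ ρ
  obtain ⟨q, hq1, hq2, hq⟩ := exists_coupling_discrete hp0 x _ _ hσ1 hρ1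
    fun y z => Metric.edist_le_ediam_of_mem (mem_univ y) (mem_univ z)
  have hprob : ∀ (κ : ProbabilityMeasure X) (Q : Measure (X × X)), Q.fst = κ →
      IsProbabilityMeasure Q.snd := fun κ Q h =>
    ⟨by rw [Measure.snd_univ, ← Measure.fst_univ, h, measure_univ]⟩
  let σ' : ProbabilityMeasure X := ⟨qσ.snd, hprob σ qσ hqσ1⟩
  let ρ' : ProbabilityMeasure X := ⟨qρ.snd, hprob ρ qρ hqρ1⟩
  -- Gather `σ` into finitely many points, adjust the weights there, and spread out to `ρ`.
  calc WSharp (Φ σ) (Φ ρ) ≤ WSharp (Φ σ) (Φ σ') + WSharp (Φ σ') (Φ ρ') + WSharp (Φ ρ') (Φ ρ) :=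
        (WSharp_triangle hp _ _ _).trans (by gcongr; exact WSharp_triangle hp _ _ _)
    _ ≤ ENNReal.ofReal ε + ENNReal.ofReal ε + ENNReal.ofReal ε := by
        gcongr
        · exact hle qσ _ hqσ1 rfl hqσ
        · exact hle q _ (hq1.trans hqσ2.symm) (hq2.trans hqρ2.symm) (hq.trans hσ)
        · rw [WSharp_comm hp]
          exact hle qρ _ hqρ1 rfl hqρ
    _ ≤ δ := hεδ

end Weak

/-! ### Lipschitz test functions -/

/-- Jensen's inequality for a finite family of measures of total mass one, viewed as a single
probability measure on the disjoint union. -/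
theorem sum_lintegral_enorm_le_rpow {Ω : Type*} [MeasurableSpace Ω] {n : ℕ}
    (κ : Fin n → Measure Ω) (hκ : ∑ i, κ i univ = 1) {F : Fin n → Ω → ℝ}
    (hF : ∀ i, Measurable (F i)) {p : ℝ} (hp : 1 ≤ p) :
    ∑ i, ∫⁻ z, ‖F i z‖ₑ ∂(κ i) ≤ (∑ i, ∫⁻ z, ‖F i z‖ₑ ^ p ∂(κ i)) ^ (1 / p) := by
  let P : Measure (Fin n × Ω) := ∑ i, (κ i).map (Prod.mk i)
  have hP : ∀ f : Fin n × Ω → ℝ≥0∞, Measurable f →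
      ∫⁻ w, f w ∂P = ∑ i, ∫⁻ z, f (i, z) ∂(κ i) := by
    intro f hf
    rw [lintegral_finsetSum_measure]
    exact Finset.sum_congr rfl fun i _ => lintegral_map hf measurable_prodMk_left
  have hprob : IsProbabilityMeasure P := ⟨by
    rw [← lintegral_one, hP _ measurable_const]
    simpa using hκ⟩
  have hmeas : Measurable fun w : Fin n × Ω => F w.1 w.2 :=
    measurable_from_prod_countable_right hF
  have h := eLpNorm'_le_eLpNorm'_of_exponent_le zero_lt_one hp P hmeas.aestronglyMeasurable
  simp only [eLpNorm', ENNReal.rpow_one, div_one] at h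
  rwa [hP _ hmeas.enorm, hP _ (hmeas.enorm.pow_const p)] at h

section LowerBound

variable {X : Type*} [MetricSpace X] [MeasurableSpace X] [BorelSpace X] {Y : Set X} {p : ℝ}

theorem enorm_add_le_dStar {X : Type*} [MetricSpace X] {Y : Set X} {f : X → ℝ}
    (hf : LipschitzWith 1 f) (hf0 : ∀ x, x ∉ Y → f x = 0) (x y : X) :
    ‖f x + f y‖ₑ ≤ dStar Y x y := by
  refine le_iInf₂ fun z hz => (enorm_add_le _ _).trans (add_le_add ?_ ?_)
  · simpa [hf0 z hz, edist_zero_right] using hf x z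
  · rw [edist_comm]
    simpa [hf0 z hz, edist_zero_right] using hf y z

instance isFiniteMeasure_ext (μ : SubProb Y) : IsFiniteMeasure μ.ext := ⟨by
  rw [SubProb.ext, Measure.map_apply measurable_subtype_coe MeasurableSet.univ, preimage_univ]
  exact μ.2.trans_lt ENNReal.one_lt_top⟩

variable [CompactSpace X]

/-- Functions that vanish outside `Y` see an annihilating pair of particles as if each of them had
been moved to the boundary; hence the bound for 1-Lipschitz functions known for transport costs
extends to charged couplings. -/
theorem edist_integral_le_of_coupling {f : X → ℝ} (hf : LipschitzWith 1 f)
    (hf0 : ∀ x, x ∉ Y → f x = 0) (hp : 1 ≤ p) {σ τ : ChargedProb Y} {μ ν : SubProb Y}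
    (hσ : σ.HasEffectiveMeasure μ) (hτ : τ.HasEffectiveMeasure ν) (q : ChargedCoupling σ τ) :
    edist (∫ x, f x ∂μ.ext) (∫ x, f x ∂ν.ext) ≤ q.cost p ^ (1 / p) := by
  have hp0 : 0 ≤ p := zero_le_one.trans hp
  let κ : Fin 4 → Measure (X × X) := ![q.pp, q.pm, q.mp, q.mm]
  have hκ : ∑ i, κ i univ = 1 := by
    rw [← σ.mass, ← q.fst_pos, ← q.fst_neg]
    simp only [Measure.coe_add, Pi.add_apply, Measure.fst_univ, κ, Fin.sum_univ_four]
    simp [add_assoc]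
  have hκf : ∀ i, IsFiniteMeasure (κ i) := fun i =>
    ⟨((Finset.single_le_sum (f := fun i => κ i univ) (fun _ _ => zero_le)
      (Finset.mem_univ i)).trans_lt (hκ.trans_lt ENNReal.one_lt_top))⟩
  have hpp : IsFiniteMeasure q.pp := hκf 0
  have hpm : IsFiniteMeasure q.pm := hκf 1
  have hmp : IsFiniteMeasure q.mp := hκf 2
  have hmm : IsFiniteMeasure q.mm := hκf 3
  have hint : ∀ {Z : Type _} [TopologicalSpace Z] [CompactSpace Z] [MeasurableSpace Z]
      [OpensMeasurableSpace Z] (κ : Measure Z) [IsFiniteMeasure κ] (g : Z → ℝ),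
      Continuous g → Integrable g κ := fun κ _ g hg =>
    (BoundedContinuousFunction.mkOfCompact ⟨g, hg⟩).integrable κ
  have hc := hf.continuous
  have hc1 : Continuous fun z : X × X => f z.1 := hc.comp continuous_fst
  have hc2 : Continuous fun z : X × X => f z.2 := hc.comp continuous_snd
  have hfst : ∀ κ : Measure (X × X), ∫ x, f x ∂κ.fst = ∫ z, f z.1 ∂κ := fun κ =>
    integral_map measurable_fst.aemeasurable hc.measurable.aestronglyMeasurable
  have hsnd : ∀ κ : Measure (X × X), ∫ x, f x ∂κ.snd = ∫ z, f z.2 ∂κ := fun κ =>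
    integral_map measurable_snd.aemeasurable hc.measurable.aestronglyMeasurable
  have hσn : IsFiniteMeasure σ.neg := by rw [← q.fst_neg]; infer_instance
  have hτn : IsFiniteMeasure τ.neg := by rw [← q.snd_neg]; infer_instance
  have h1 : ∫ x, f x ∂σ.pos = ∫ x, f x ∂σ.neg + ∫ x, f x ∂μ.ext := by
    rw [hσ, integral_add_measure (hint _ f hc) (hint _ f hc)]
  have h2 : ∫ x, f x ∂τ.pos = ∫ x, f x ∂τ.neg + ∫ x, f x ∂ν.ext := by
    rw [hτ, integral_add_measure (hint _ f hc) (hint _ f hc)]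
  rw [← q.fst_pos, ← q.fst_neg, integral_add_measure (hint _ f hc) (hint _ f hc),
    integral_add_measure (hint _ f hc) (hint _ f hc), hfst, hfst, hfst, hfst] at h1
  rw [← q.snd_pos, ← q.snd_neg, integral_add_measure (hint _ f hc) (hint _ f hc),
    integral_add_measure (hint _ f hc) (hint _ f hc), hsnd, hsnd, hsnd, hsnd] at h2
  -- On the doubled space, `f` is extended oddly: by `f` on the positive and `-f` on the negative
  -- sheet. The extension is 1-Lipschitz since `f` vanishes where the sheets are glued.
  let F : Fin 4 → X × X → ℝ := ![fun z => f z.1 - f z.2, fun z => f z.1 + f z.2,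
    fun z => -(f z.1 + f z.2), fun z => -(f z.1 - f z.2)]
  have hF : ∀ i, Measurable (F i) := by
    intro i
    fin_cases i <;> simp only [F] <;>
      [exact (hc1.sub hc2).measurable; exact (hc1.add hc2).measurable;
        exact (hc1.add hc2).neg.measurable; exact (hc1.sub hc2).neg.measurable]
  have hsum : ∫ x, f x ∂μ.ext - ∫ x, f x ∂ν.ext = ∑ i, ∫ z, F i z ∂(κ i) := by
    simp only [Fin.sum_univ_four, F, κ, Matrix.cons_val, integral_neg]
    rw [integral_sub (hint _ _ hc1) (hint _ _ hc2), integral_sub (hint _ _ hc1) (hint _ _ hc2),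
      integral_add (hint _ _ hc1) (hint _ _ hc2), integral_add (hint _ _ hc1) (hint _ _ hc2)]
    linarith
  have hcost : ∑ i, ∫⁻ z, ‖F i z‖ₑ ^ p ∂(κ i) ≤ q.cost p := by
    simp only [Fin.sum_univ_four, F, κ, Matrix.cons_val, ChargedCoupling.cost, enorm_neg]
    have hd : ∀ z : X × X, ‖f z.1 - f z.2‖ₑ ^ p ≤ edist z.1 z.2 ^ p := fun z =>
      ENNReal.rpow_le_rpow (by simpa [edist_eq_enorm_sub] using hf z.1 z.2) hp0
    have hs : ∀ z : X × X, ‖f z.1 + f z.2‖ₑ ^ p ≤ dStar Y z.1 z.2 ^ p := fun z =>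
      ENNReal.rpow_le_rpow (enorm_add_le_dStar hf hf0 _ _) hp0
    exact add_le_add (add_le_add (add_le_add (lintegral_mono hd) (lintegral_mono hs))
      (lintegral_mono hs)) (lintegral_mono hd)
  rw [edist_eq_enorm_sub, hsum]
  calc ‖∑ i, ∫ z, F i z ∂(κ i)‖ₑ ≤ ∑ i, ‖∫ z, F i z ∂(κ i)‖ₑ := enorm_sum_le _ _
    _ ≤ ∑ i, ∫⁻ z, ‖F i z‖ₑ ∂(κ i) :=
        Finset.sum_le_sum fun i _ => enorm_integral_le_lintegral_enorm _
    _ ≤ _ := sum_lintegral_enorm_le_rpow κ hκ hF hp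
    _ ≤ _ := ENNReal.rpow_le_rpow hcost (by positivity)

theorem edist_integral_le_WZero {f : X → ℝ} (hf : LipschitzWith 1 f)
    (hf0 : ∀ x, x ∉ Y → f x = 0) (hp : 1 ≤ p) (μ ν : SubProb Y) :
    edist (∫ x, f x ∂μ.ext) (∫ x, f x ∂ν.ext) ≤ WZero p μ ν := by
  have hp0 : 0 < p := zero_lt_one.trans_le hp
  refine le_iInf₂ fun σ τ => le_iInf₂ fun hσ hτ => ?_
  rw [Wtilde, one_div, ENNReal.le_rpow_inv_iff hp0]
  refine le_iInf fun q => ?_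
  rw [← ENNReal.le_rpow_inv_iff hp0, ← one_div]
  exact edist_integral_le_of_coupling hf hf0 hp hσ hτ q

theorem edist_integral_le_WFlat {f : X → ℝ} (hf : LipschitzWith 1 f)
    (hf0 : ∀ x, x ∉ Y → f x = 0) (hp : 1 ≤ p) (μ ν : SubProbP p Y) :
    edist (∫ x, f x ∂μ.1.ext) (∫ x, f x ∂ν.1.ext) ≤ WFlat μ ν := by
  refine le_of_forall_gt fun r hr => ?_
  obtain ⟨n, c, rfl, rfl, hc⟩ := exists_chain_of_WFlat_lt hr
  refine ((edist_le_range_sum_edist (fun i => ∫ x, f x ∂(c i).1.ext) n).trans ?_).trans_lt hc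
  exact Finset.sum_le_sum fun i _ => edist_integral_le_WZero hf hf0 hp _ _

/-- Subprobability measures at distance zero integrate the functions `min (infDist x Vᶜ) (1 / n)`,
for `V ⊆ Y` open, in the same way, hence coincide on the open subsets of `Y`. -/
theorem eq_of_WFlat_eq_zero (hY : IsOpen Y) (hne : Y ≠ univ) (hp : 1 ≤ p) {μ ν : SubProbP p Y}
    (h : WFlat μ ν = 0) : μ = ν := by
  have hlip : ∀ f : X → ℝ, LipschitzWith 1 f → (∀ x, x ∉ Y → f x = 0) →
      ∫ x, f x ∂μ.1.ext = ∫ x, f x ∂ν.1.ext := fun f hf hf0 =>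
    edist_eq_zero.1 (le_antisymm ((edist_integral_le_WFlat hf hf0 hp μ ν).trans h.le) zero_le)
  obtain ⟨z, hz⟩ := (ne_univ_iff_exists_notMem Y).1 hne
  have hopen : ∀ V : Set X, IsOpen V → V ⊆ Y → μ.1.ext V = ν.1.ext V := by
    intro V hV hVY
    have hVc : (Vᶜ).Nonempty := ⟨z, fun hzV => hz (hVY hzV)⟩
    let g : ℕ → X → ℝ := fun n x => min (Metric.infDist x Vᶜ) (1 / ((n : ℝ) + 1))
    have hg : ∀ n, LipschitzWith 1 (g n) := fun n =>
      (Metric.lipschitz_infDist_pt _).min_const _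
    have hg0 : ∀ n x, x ∉ V → g n x = 0 := by
      intro n x hx
      simp only [g]
      rw [Metric.infDist_zero_of_mem (by simpa using hx)]
      exact min_eq_left (by positivity)
    have hlim : ∀ κ : Measure X, IsFiniteMeasure κ →
        Tendsto (fun n : ℕ => ((n : ℝ) + 1) * ∫ x, g n x ∂κ) atTop (𝓝 (κ.real V)) := by
      intro κ _
      simp_rw [← integral_const_mul]
      rw [← integral_indicator_one hV.measurableSet]
      refine tendsto_integral_of_dominated_convergence (fun _ => 1)
        (fun n => ((hg n).continuous.const_mul _).measurable.aestronglyMeasurable)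
        (integrable_const 1) (fun n => ae_of_all _ fun x => ?_) (ae_of_all _ fun x => ?_)
      · have h0 : 0 ≤ g n x := le_min Metric.infDist_nonneg (by positivity)
        have h1 : g n x ≤ 1 / ((n : ℝ) + 1) := min_le_right _ _
        rw [Real.norm_of_nonneg (by positivity)]
        calc ((n : ℝ) + 1) * g n x ≤ (n + 1) * (1 / (n + 1)) := by gcongr
          _ = 1 := by field_simp
      · by_cases hx : x ∈ V
        · have hpos : 0 < Metric.infDist x Vᶜ :=
            (hV.isClosed_compl.notMem_iff_infDist_pos hVc).1 (by simpa using hx)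
          refine tendsto_const_nhds.congr' ?_
          filter_upwards [(tendsto_one_div_add_atTop_nhds_zero_nat (𝕜 := ℝ)).eventually
            (gt_mem_nhds hpos)] with n hn
          simp only [g, min_eq_right hn.le, indicator_of_mem hx, Pi.one_apply]
          field_simp
        · simp [hg0 _ x hx, indicator_of_notMem hx]
    have hμν := tendsto_nhds_unique (hlim μ.1.ext inferInstance) ((hlim ν.1.ext inferInstance).congr
      fun n => by rw [hlip (g n) (hg n) fun x hx => hg0 n x fun hxV => hx (hVY hxV)])
    exact (measureReal_eq_measureReal_iff).1 hμν
  have hext : ∀ κ : SubProb Y, ∀ V : Set X, MeasurableSet V → κ.ext V = κ.ext (V ∩ Y) := by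
    intro κ V hV
    rw [SubProb.ext, Measure.map_apply measurable_subtype_coe hV,
      Measure.map_apply measurable_subtype_coe (hV.inter hY.measurableSet)]
    congr 1
    ext y
    simp
  have hall : ∀ V : Set X, IsOpen V → μ.1.ext V = ν.1.ext V := fun V hV => by
    rw [hext _ V hV.measurableSet, hext _ V hV.measurableSet]
    exact hopen _ (hV.inter hY) inter_subset_right
  have heq : μ.1.ext = ν.1.ext :=
    ext_of_generate_finite {V | IsOpen V} (BorelSpace.measurable_eq (α := X)) isPiSystem_isOpen
      (fun V hV => hall V hV) (hall univ isOpen_univ)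
  refine Subtype.ext (Subtype.ext ?_)
  rw [← SubProb.comap_ext hY.measurableSet μ.1, heq, SubProb.comap_ext hY.measurableSet]

theorem WSharp_ne_top (hX : IsGeodesicSpace X) (hY : MeasurableSet Y) (hnonempty : Y.Nonempty)
    (hne : Y ≠ univ) (hp : 1 ≤ p) (μ ν : SubProbP p Y) : WSharp μ ν ≠ ∞ := by
  have hp' : 0 ≤ p := zero_le_one.trans hp
  obtain ⟨ρ, rfl⟩ := SubProbP.restrict_surjective hY hnonempty hne hp' μ
  obtain ⟨σ, rfl⟩ := SubProbP.restrict_surjective hY hnonempty hne hp' ν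
  refine ((WSharp_restrict_le hX hY hnonempty hne hp hp' ((ρ : Measure X).prod σ) (by simp)
    (by simp)).trans_lt ?_).ne
  exact ENNReal.rpow_lt_top_of_nonneg (by positivity) (lintegral_edist_rpow_lt_top hp' _).ne

end LowerBound

/-! ### The metric space of subprobability measures -/

section MetricSpace

variable {X : Type*} [MetricSpace X] [MeasurableSpace X] [BorelSpace X] [CompactSpace X]
  {Y : Set X} {p : ℝ}

/-- The transportation-annihilation distance as a metric. -/
noncomputable abbrev sharpMetricSpace (hX : IsGeodesicSpace X) (hY : IsOpen Y)
    (hnonempty : Y.Nonempty) (hne : Y ≠ univ) (hp : 1 ≤ p) : MetricSpace (SubProbP p Y) :=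
  letI : EMetricSpace (SubProbP p Y) :=
    { edist := WSharp
      edist_self := WSharp_self hp
      edist_comm := WSharp_comm hp
      edist_triangle := WSharp_triangle hp
      eq_of_edist_eq_zero := fun {μ ν} h => eq_of_WFlat_eq_zero hY hne hp
        (le_antisymm ((WFlat_le_WSharp hp μ ν).trans (le_of_eq h)) zero_le) }
  EMetricSpace.toMetricSpace (WSharp_ne_top hX hY.measurableSet hnonempty hne hp)

/-- Integrals against the restriction to `Y` of a measure on `X` of continuous functions with
compact support in `Y` depend continuously on the measure. -/
theorem continuous_integral_restrict (hY : IsOpen Y) {f : Y → ℝ} (hf : Continuous f)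
    (hf' : HasCompactSupport f) :
    Continuous fun ρ : ProbabilityMeasure X => ∫ y, f y ∂(SubProb.restrict Y ρ).1 := by
  have hF : Continuous (Subtype.val.extend f 0) := hf'.continuous_extend_zero hY hf
  have heq : ∀ ρ : ProbabilityMeasure X, ∫ y, f y ∂(SubProb.restrict Y ρ).1
      = ∫ x, Subtype.val.extend f 0 x ∂(ρ : Measure X) := by
    intro ρ
    have h1 : ∀ y : Y, f y = Subtype.val.extend f 0 (y : X) := fun y =>
      (Subtype.val_injective.extend_apply f 0 y).symm
    rw [integral_congr_ae (ae_of_all _ h1)]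
    refine (integral_subtype_comap hY.measurableSet _).trans
      (setIntegral_eq_integral_of_forall_compl_eq_zero fun x hx => ?_)
    exact Function.extend_apply' _ _ _ fun ⟨y, hy⟩ => hx (hy ▸ y.2)
  simp_rw [heq]
  exact ProbabilityMeasure.continuous_integral_boundedContinuousFunction
    (BoundedContinuousFunction.mkOfCompact ⟨_, hF⟩)

theorem SubProb.eq_of_forall_integral_eq (hY : IsOpen Y) {μ ν : SubProb Y}
    (h : ∀ f : Y → ℝ, Continuous f → HasCompactSupport f → ∫ y, f y ∂μ.1 = ∫ y, f y ∂ν.1) :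
    μ = ν := by
  have : LocallyCompactSpace Y := hY.locallyCompactSpace
  have : IsFiniteMeasure μ.1 := ⟨μ.2.trans_lt ENNReal.one_lt_top⟩
  have : IsFiniteMeasure ν.1 := ⟨ν.2.trans_lt ENNReal.one_lt_top⟩
  exact Subtype.ext (Measure.ext_of_integral_eq_on_compactlySupported fun f =>
    h f f.continuous f.hasCompactSupport)

end MetricSpace

end TransportAnnihilation

open TransportAnnihilation in
theorem proposition1p9 {X : Type*} [MetricSpace X] [CompactSpace X] [MeasurableSpace X]
    [BorelSpace X] (hX : TransportAnnihilation.IsGeodesicSpace X)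
    (Y : Set X) (hY : IsOpen Y) (hY_nonempty : Y.Nonempty) (hY_ne : Y ≠ Set.univ)
    (p : ℝ) (hp : 1 ≤ p) :
    (∃ m : MetricSpace (TransportAnnihilation.SubProbP p Y),
      (∀ μ ν : TransportAnnihilation.SubProbP p Y,
        edist μ ν = TransportAnnihilation.WSharp μ ν) ∧
      CompleteSpace (TransportAnnihilation.SubProbP p Y) ∧
      TopologicalSpace.SeparableSpace (TransportAnnihilation.SubProbP p Y) ∧
      TransportAnnihilation.IsGeodesicSpace (TransportAnnihilation.SubProbP p Y)) ∧
    (∀ (μs : ℕ → TransportAnnihilation.SubProbP p Y) (μ : TransportAnnihilation.SubProbP p Y),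
      TransportAnnihilation.VagueTendsto (fun n => (μs n).1) μ.1 ↔
        Tendsto (fun n => TransportAnnihilation.WSharp (μs n) μ) atTop (𝓝 0)) := by
  have hp' : 0 ≤ p := zero_le_one.trans hp
  let _ : MetricSpace (SubProbP p Y) := sharpMetricSpace hX hY hY_nonempty hY_ne hp
  have hedist : ∀ μ ν : SubProbP p Y, edist μ ν = WSharp μ ν := fun _ _ => rfl
  let Φ : ProbabilityMeasure X → SubProbP p Y :=
    SubProbP.restrict hY.measurableSet hY_nonempty hY_ne hp'
  have hΦs : Function.Surjective Φ :=
    SubProbP.restrict_surjective hY.measurableSet hY_nonempty hY_ne hp'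
  have hΦ : Continuous Φ := continuous_iff_continuousAt.2 fun ρ =>
    tendsto_iff_edist_tendsto_0.2
      (tendsto_WSharp_restrict hX hY.measurableSet hY_nonempty hY_ne hp hp' ρ)
  have hcompact : CompactSpace (SubProbP p Y) := ⟨hΦs.range_eq ▸ isCompact_range hΦ⟩
  -- A continuous surjection from a compact space onto a Hausdorff space is a quotient map.
  have hvague : ∀ f : Y → ℝ, Continuous f → HasCompactSupport f →
      Continuous fun μ : SubProbP p Y => ∫ y, f y ∂μ.1.1 := fun f hf hf' =>
    (IsQuotientMap.of_surjective_continuous hΦs hΦ).continuous_iff.2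
      (continuous_integral_restrict hY hf hf')
  refine ⟨⟨inferInstance, hedist, inferInstance, inferInstance, ?_⟩,
    fun μs μ => ⟨fun h => ?_, fun h => ?_⟩⟩
  · exact isGeodesicSpace_of_compactSpace_of_edist_eq_lengthEDist (M := FlatSpace p Y hp)
      (Equiv.refl _) fun μ ν => WSharp_eq_lengthEDist (hp := hp) μ ν
  -- By compactness it suffices that `μ` is the only cluster point.
  · suffices hlim : Tendsto μs atTop (𝓝 μ) from
      tendsto_iff_edist_tendsto_0.1 hlim
    refine tendsto_nhds_of_unique_mapClusterPt fun ν hν => ?_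
    refine Subtype.ext (SubProb.eq_of_forall_integral_eq hY fun f hf hf' => ?_)
    have h1 : MapClusterPt (∫ y, f y ∂ν.1.1) atTop fun n => ∫ y, f y ∂(μs n).1.1 :=
      hν.continuousAt_comp (hvague f hf hf').continuousAt
    exact eq_of_nhds_neBot (ClusterPt.mono h1 (h f hf hf'))
  · intro f hf hf'
    exact ((hvague f hf hf').tendsto μ).comp (tendsto_iff_edist_tendsto_0.2 h)
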